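/- **Conventions.** Everything is smooth ($C^\infty$). Let $D$ be a smooth surface and $S:TD\to TD$ a smooth field of endomorphisms with distinct real eigenvalue functions $A,B$ (smooth, listed in a chosen order), so $S=A\,\mathbf a\otimes\alpha+B\,\mathbf b\otimes\beta$ with $(\alpha,\beta)$ dual to $(\mathbf a,\mathbf b)$. For a function $h$ write $dh=d'h+d''h$ with $d'h$ a multiple of $\alpha$ and $d''h$ a multiple of $\beta$. $S$ is *invertible* if $A,B$ vanish nowhere and *nondegenerate* if $A-B$, $d''A$, $d'B$ vanish nowhere. Then $$\theta_1=\frac{A\,d'B}{B(B-A)},\qquad \theta_2=\frac{B\,d''A}{A(A-B)}$$ is a coframing. $S$ (with the eigenvalues in the order $A,B$) is *of Type I* if for some functions $K_2,K_{21}$ $$d\theta_1=\theta_1\wedge\theta_2,\qquad d\theta_2=K_2\,\theta_2\wedge\theta_1,\qquad dK_2=K_{21}\,\theta_1+2(K_2-1)\,\theta_2 .$$ (The dual form of the Type I equations is this one with the two eigenvalues exchanged.) Principal curves of the first (second) family are the integral curves of $\theta_2=0$ ($\theta_1=0$); an open set is *$\theta$-rectangular* if in it each principal curve of the first family meets each one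 of the second family in exactly one point. For functions $f,\phi_0,\phi_1$ of $x$ and $g$ of $y$ with $\phi_1'(x)-y\,\phi_0'(x)$ nowhere zero, put $$U=f(x)-\frac{g(y)}{\phi_1'(x)-y\phi_0'(x)}-\frac{\phi_1(x)-y\phi_0(x)}{\phi_1'(x)-y\phi_0'(x)}\,f'(x),\qquad V=f(x)-\phi_0(x)\,g(y)-\bigl(\phi_1(x)-y\phi_0(x)\bigr)g'(y).$$ **Theorem.** (1) Let $S$ be an invertible, nondegenerate operator of Type I on $D$. Each point of $D$, inside any coordinate neighbourhood of it, has a $\theta$-rectangular neighbourhood $R$ with smooth coordinates $(x,y)$ mapping $R$ onto a rectangle $x(R)\times y(R)$, and there are smooth functions $f,\phi_0,\phi_1$ on $x(R)$ and $g$ on $y(R)$ with $\phi_0\phi_1'-\phi_1\phi_0'=1$ and $\phi_1'-y\phi_0'$ nowhere zero, such that on $R$ one has $A=1/U$, $B=1/V$ and $$S=\frac1U\,\frac{\partial}{\partial x}\otimes dx+\frac1V\,\frac{\partial}{\partial y}\otimes dy .$$ (2) Moreover, $R$ and these data can be chosen so that $x,y,f,g,\phi_0,\phi_1$ are computable from the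 components of $S$, in any given local coordinates, by algebraic operations, quadratures and the integration of a single linear, self-adjoint second-order ordinary differential equation on $x(R)$, in the following sense. Say that a function on $R$ is obtained *by quadratures* from given functions if it is obtained from them and constants by finitely many arithmetic operations, extractions of simple roots of polynomials, partial differentiations, exponentiations, and quadratures (finding $h$ from a closed $1$-form $dh$ whose components are already known). Then there are a curve $\{c=0\}$ transverse to the principal curves of the second family, with $c$ obtained by quadratures from the components of $S$, and a smooth function $w$ on $R$, the integral of $\theta_2$ along principal curves of the second family starting from $\{c=0\}$ (a quadrature with parameters), and a smooth function $\mu$ on $x(R)$, such that: $x$ and $\mu(x)$ are obtained by quadratures from the components of $S$ and $w$; $\phi_0,\phi_1$ are solutions on $x(R)$ of $\phi''+\mu\,\phi=0$; and $y$, $f(x)$, $g(y)$ are obtained by quadratures from the components of $S$, $w$, $\phi_0(x)$ and $\phi_1(x)$. (3) Conversely, let $R$ be an open rectangle (product of two open intervals) in the $xy$-plane, and let $f,\phi_0,\phi_1$ on $x(R)$ and $g$ on $y(R)$ be smooth with $\phi_0\phi_1'-\phi_1\phi_0'=1$ and $\phi_1'-y\phi_0'$ nowhere zero on $R$, such that $U$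 and $V$ are nowhere zero and nowhere equal on $R$. Then $S=\frac1U\frac{\partial}{\partial x}\otimes dx+\frac1V\frac{\partial}{\partial y}\otimes dy$ is an invertible, nondegenerate operator on $R$ which, with the eigenvalues in the order $1/U,1/V$, satisfies the Type I structure equations above, and $(x,y)$ are principal coordinates for its coframing: $\theta_1=s\,dx$ and $\theta_2=t\,dy$ with $s,t$ nowhere zero. -/

import Mathlib

open Set
open scoped Manifold ContDiff

/-! ### Operators on open sets of the plane -/

/-- The coordinate plane. -/
abbrev Plane : Type := ℝ × ℝ

/-- A field of endomorphisms of the tangent planes, written in coordinates. -/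
abbrev OperatorField : Type := Plane → (Plane →L[ℝ] Plane)

/-- A field of covectors (a `1`-form), written in coordinates. -/
abbrev OneForm : Type := Plane → (Plane →L[ℝ] ℝ)

/-- The value at `q` of the exterior derivative of a `1`-form on a pair of vectors. -/
noncomputable def dForm (σ : OneForm) (q v w : Plane) : ℝ :=
  fderiv ℝ σ q v w - fderiv ℝ σ q w v

/-- The value at `q` of the wedge product of two `1`-forms on a pair of vectors. -/
def wedge (σ τ : OneForm) (q v w : Plane) : ℝ :=
  σ q v * τ q w - σ q w * τ q v

/-- When `S q` has the distinct eigenvalues `A q` and `B q`, this is the projection onto the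
`A q`-eigenline along the `B q`-eigenline. With the two eigenvalue functions exchanged it is the
projection onto the other eigenline. -/
noncomputable def eigenProj (S : OperatorField) (A B : Plane → ℝ) (q : Plane) :
    Plane →L[ℝ] Plane :=
  (A q - B q)⁻¹ • (S q - B q • ContinuousLinearMap.id ℝ Plane)

/-- The component `d' h` of `dh` that vanishes on the `B`-eigenlines
(a multiple of `α`, if `S = A a ⊗ α + B b ⊗ β`). -/
noncomputable def dPrime (S : OperatorField) (A B : Plane → ℝ) (h : Plane → ℝ) : OneForm :=
  fun q => (fderiv ℝ h q).comp (eigenProj S A B q)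

/-- The component `d'' h` of `dh` that vanishes on the `A`-eigenlines (a multiple of `β`). -/
noncomputable def dDoublePrime (S : OperatorField) (A B : Plane → ℝ) (h : Plane → ℝ) : OneForm :=
  fun q => (fderiv ℝ h q).comp (eigenProj S B A q)

/-- `θ₁ = A d'B / (B (B - A))`. -/
noncomputable def theta1 (S : OperatorField) (A B : Plane → ℝ) : OneForm :=
  fun q => (A q / (B q * (B q - A q))) • dPrime S A B B q

/-- `θ₂ = B d''A / (A (A - B))`. -/
noncomputable def theta2 (S : OperatorField) (A B : Plane → ℝ) : OneForm :=
  fun q => (B q / (A q * (A q - B q))) • dDoublePrime S A B A q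

/-- On the open set `W`, `S` is a smooth invertible nondegenerate operator whose first and second
eigenvalue functions are `A` and `B`. -/
structure IsInvertibleNondegenerateOn (W : Set Plane) (S : OperatorField) (A B : Plane → ℝ) :
    Prop where
  smooth_S : ContDiffOn ℝ ∞ S W
  smooth_A : ContDiffOn ℝ ∞ A W
  smooth_B : ContDiffOn ℝ ∞ B W
  eigen_A : ∀ q ∈ W, Module.End.HasEigenvalue (S q : Plane →ₗ[ℝ] Plane) (A q)
  eigen_B : ∀ q ∈ W, Module.End.HasEigenvalue (S q : Plane →ₗ[ℝ] Plane) (B q)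
  A_ne_B : ∀ q ∈ W, A q ≠ B q
  A_ne_zero : ∀ q ∈ W, A q ≠ 0
  B_ne_zero : ∀ q ∈ W, B q ≠ 0
  dDoublePrime_A_ne_zero : ∀ q ∈ W, dDoublePrime S A B A q ≠ 0
  dPrime_B_ne_zero : ∀ q ∈ W, dPrime S A B B q ≠ 0

/-- The Type I structure equations for a pair of `1`-forms on the open set `W`:
`dθ₁ = θ₁ ∧ θ₂`, `dθ₂ = K₂ θ₂ ∧ θ₁`, `dK₂ = K₂₁ θ₁ + 2 (K₂ - 1) θ₂`. -/
def TypeIStructureEquations (W : Set Plane) (θ₁ θ₂ : OneForm) : Prop :=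
  ∃ K₂ K₂₁ : Plane → ℝ, ContDiffOn ℝ ∞ K₂ W ∧ ∀ q ∈ W,
    (∀ v w : Plane, dForm θ₁ q v w = wedge θ₁ θ₂ q v w) ∧
    (∀ v w : Plane, dForm θ₂ q v w = K₂ q * wedge θ₂ θ₁ q v w) ∧
    fderiv ℝ K₂ q = K₂₁ q • θ₁ q + (2 * (K₂ q - 1)) • θ₂ q

/-- `S`, with its eigenvalue functions taken in the order `A`, `B`, is an invertible nondegenerate
operator on the open set `W` whose coframing satisfies the Type I structure equations. -/
def IsTypeIOn (W : Set Plane) (S : OperatorField) (A B : Plane → ℝ) : Prop :=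
  IsInvertibleNondegenerateOn W S A B ∧
    TypeIStructureEquations W (theta1 S A B) (theta2 S A B)

/-! ### Operators on surfaces -/

/-- The expression, in the coordinates given by the chart `e`, of a field of endomorphisms of the
tangent planes of a surface. -/
noncomputable def localRep {M : Type*} [TopologicalSpace M] [ChartedSpace Plane M]
    (S : ∀ p : M, TangentSpace 𝓘(ℝ, Plane) p →L[ℝ] TangentSpace 𝓘(ℝ, Plane) p)
    (e : OpenPartialHomeomorph M Plane) : OperatorField :=
  fun q => (mfderiv 𝓘(ℝ, Plane) 𝓘(ℝ, Plane) e (e.symm q)).comp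
    ((S (e.symm q)).comp (mfderiv 𝓘(ℝ, Plane) 𝓘(ℝ, Plane) e.symm q))

/-- `S`, with its eigenvalue functions taken in the order `A`, `B`, is a smooth invertible
nondegenerate operator on the surface `M` whose coframing satisfies the Type I structure equations:
this holds in all smooth coordinates. -/
def IsTypeI {M : Type*} [TopologicalSpace M] [ChartedSpace Plane M]
    (S : ∀ p : M, TangentSpace 𝓘(ℝ, Plane) p →L[ℝ] TangentSpace 𝓘(ℝ, Plane) p)
    (A B : M → ℝ) : Prop :=
  ∀ e ∈ IsManifold.maximalAtlas 𝓘(ℝ, Plane) ∞ M,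
    IsTypeIOn e.target (localRep S e) (A ∘ e.symm) (B ∘ e.symm)

/-! ### Principal curves and rectangularity -/

/-- `γ`, with velocity `γ'`, is a `C¹` curve `[0, 1] → W` along which the `1`-form `θ` vanishes. -/
def IsLeafPath (W : Set Plane) (θ : OneForm) (γ γ' : ℝ → Plane) : Prop :=
  ContinuousOn γ' (Icc 0 1) ∧ ∀ t ∈ Icc (0 : ℝ) 1,
    HasDerivWithinAt γ (γ' t) (Icc 0 1) t ∧ γ t ∈ W ∧ θ (γ t) (γ' t) = 0

/-- `a` and `b` lie on the same integral curve of `θ = 0` in `W`. -/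
def SameLeaf (W : Set Plane) (θ : OneForm) (a b : Plane) : Prop :=
  ∃ γ γ' : ℝ → Plane, IsLeafPath W θ γ γ' ∧ γ 0 = a ∧ γ 1 = b

/-- `W` is rectangular for the coframing: every principal curve of the first family
(`θ₂ = 0`) meets every principal curve of the second family (`θ₁ = 0`) in a unique point. -/
def IsThetaRectangular (W : Set Plane) (θ₁ θ₂ : OneForm) : Prop :=
  ∀ a ∈ W, ∀ b ∈ W, ∃! r : Plane, SameLeaf W θ₂ a r ∧ SameLeaf W θ₁ b r

/-! ### Computability by algebraic operations and quadratures -/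

/-- The functions on `W` that can be computed from the functions in `G` by algebraic operations
(arithmetic, extraction of simple roots of polynomials, formation of partial derivatives),
exponentials, and quadratures. -/
inductive ByQuadratures (W : Set Plane) (G : Set (Plane → ℝ)) : (Plane → ℝ) → Prop
  | given (h : Plane → ℝ) (hG : h ∈ G) : ByQuadratures W G h
  | congr (h k : Plane → ℝ) (hh : ByQuadratures W G h) (heq : EqOn k h W) : ByQuadratures W G k
  | const (c : ℝ) : ByQuadratures W G (fun _ => c)
  | add (h k : Plane → ℝ) (hh : ByQuadratures W G h) (hk : ByQuadratures W G k) :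
      ByQuadratures W G (fun q => h q + k q)
  | mul (h k : Plane → ℝ) (hh : ByQuadratures W G h) (hk : ByQuadratures W G k) :
      ByQuadratures W G (fun q => h q * k q)
  | inv (h : Plane → ℝ) (hh : ByQuadratures W G h) (h0 : ∀ q ∈ W, h q ≠ 0) :
      ByQuadratures W G (fun q => (h q)⁻¹)
  | root (n : ℕ) (c : ℕ → Plane → ℝ) (h : Plane → ℝ) (hc : ∀ i, ByQuadratures W G (c i))
      (hcont : ContinuousOn h W)
      (hroot : ∀ q ∈ W, ∑ i ∈ Finset.range (n + 1), c i q * h q ^ i = 0)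
      (hsimple : ∀ q ∈ W, ∑ i ∈ Finset.range (n + 1), (i : ℝ) * c i q * h q ^ (i - 1) ≠ 0) :
      ByQuadratures W G h
  | exp (h : Plane → ℝ) (hh : ByQuadratures W G h) : ByQuadratures W G (fun q => Real.exp (h q))
  | partial₁ (h : Plane → ℝ) (hh : ByQuadratures W G h) :
      ByQuadratures W G (fun q => fderiv ℝ h q (1, 0))
  | partial₂ (h : Plane → ℝ) (hh : ByQuadratures W G h) :
      ByQuadratures W G (fun q => fderiv ℝ h q (0, 1))
  | quadrature (h : Plane → ℝ) (hd : DifferentiableOn ℝ h W)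
      (h₁ : ByQuadratures W G (fun q => fderiv ℝ h q (1, 0)))
      (h₂ : ByQuadratures W G (fun q => fderiv ℝ h q (0, 1))) : ByQuadratures W G h

/-- The four matrix entries of the operator `S` in the given coordinates. -/
def entries (S : OperatorField) : Set (Plane → ℝ) :=
  {fun q => (S q (1, 0)).1, fun q => (S q (0, 1)).1,
    fun q => (S q (1, 0)).2, fun q => (S q (0, 1)).2}

/-- `w` is obtained by a quadrature with parameters: its value at each point of `W` is the integral
of `σ` along the integral curve of `θ = 0` through that point, starting from the curve `c = 0`,
to which the integral curves of `θ = 0` are transverse. -/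
def IsParametrizedQuadrature (W : Set Plane) (θ σ : OneForm) (c w : Plane → ℝ) : Prop :=
  (∀ q ∈ W, ∃ v : Plane, θ q v = 0 ∧ fderiv ℝ c q v ≠ 0) ∧
  ∀ q ∈ W, ∃ γ γ' : ℝ → Plane, IsLeafPath W θ γ γ' ∧ c (γ 0) = 0 ∧ γ 1 = q ∧
    w q = ∫ t in (0 : ℝ)..1, σ (γ t) (γ' t)

/-- The functions `X`, `Y` on `W` and the functions `f`, `φ₀`, `φ₁`, `g` of one variable
(with `f`, `φ₀`, `φ₁` defined on the interval `I`, the range of `X`) are computable from `S` by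
algebraic operations, quadratures (one of them, `w`, being the integral of `θ₂` along the principal
curves of the second family) and the integration of the single equation `φ'' + μ φ = 0` on `I`.
The equation is itself found before it is integrated: `X` and `μ ∘ X` are computed without it.
The functions of one variable are computed as functions of the point. -/
def IsComputableFrom (W : Set Plane) (S : OperatorField) (A B : Plane → ℝ) (I : Set ℝ)
    (X Y : Plane → ℝ) (f φ₀ φ₁ g : ℝ → ℝ) : Prop :=
  ∃ (c w : Plane → ℝ) (μ : ℝ → ℝ),
    ByQuadratures W (entries S) c ∧
    ContDiffOn ℝ ∞ w W ∧
    IsParametrizedQuadrature W (theta1 S A B) (theta2 S A B) c w ∧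
    ByQuadratures W (entries S ∪ {w}) X ∧
    ByQuadratures W (entries S ∪ {w}) (μ ∘ X) ∧
    ContDiffOn ℝ ∞ μ I ∧
    (∀ x ∈ I, deriv (deriv φ₀) x + μ x * φ₀ x = 0) ∧
    (∀ x ∈ I, deriv (deriv φ₁) x + μ x * φ₁ x = 0) ∧
    ByQuadratures W (entries S ∪ {w, φ₀ ∘ X, φ₁ ∘ X}) Y ∧
    ByQuadratures W (entries S ∪ {w, φ₀ ∘ X, φ₁ ∘ X}) (f ∘ X) ∧
    ByQuadratures W (entries S ∪ {w, φ₀ ∘ X, φ₁ ∘ X}) (g ∘ Y)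

/-! ### The explicit normal form -/

/-- The explicit function `U`. -/
noncomputable def explicitU (f φ₀ φ₁ g : ℝ → ℝ) (q : Plane) : ℝ :=
  f q.1 - g q.2 / (deriv φ₁ q.1 - q.2 * deriv φ₀ q.1)
    - (φ₁ q.1 - q.2 * φ₀ q.1) / (deriv φ₁ q.1 - q.2 * deriv φ₀ q.1) * deriv f q.1

/-- The explicit function `V`. -/
noncomputable def explicitV (f φ₀ φ₁ g : ℝ → ℝ) (q : Plane) : ℝ :=
  f q.1 - φ₀ q.1 * g q.2 - (φ₁ q.1 - q.2 * φ₀ q.1) * deriv g q.2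

/-- The operator `a ∂x ⊗ dx + b ∂y ⊗ dy`. -/
noncomputable def diagOperator (a b : ℝ) : Plane →L[ℝ] Plane :=
  (a • ContinuousLinearMap.fst ℝ ℝ ℝ).prod (b • ContinuousLinearMap.snd ℝ ℝ ℝ)

/-- The first eigenvalue function `1 / U`. -/
noncomputable def explicitA (f φ₀ φ₁ g : ℝ → ℝ) : Plane → ℝ :=
  fun q => 1 / explicitU f φ₀ φ₁ g q

/-- The second eigenvalue function `1 / V`. -/
noncomputable def explicitB (f φ₀ φ₁ g : ℝ → ℝ) : Plane → ℝ :=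
  fun q => 1 / explicitV f φ₀ φ₁ g q

/-- The operator `(1 / U) ∂x ⊗ dx + (1 / V) ∂y ⊗ dy`. -/
noncomputable def explicitS (f φ₀ φ₁ g : ℝ → ℝ) : OperatorField :=
  fun q => diagOperator (explicitA f φ₀ φ₁ g q) (explicitB f φ₀ φ₁ g q)

/-- Admissible data for the normal form on the rectangle `I × J`: smooth functions `f`, `φ₀`, `φ₁`
on `I` and `g` on `J`, with `φ₀ φ₁' - φ₁ φ₀' = 1`, such that the denominator in the formula for `U`
does not vanish on the rectangle. -/
structure IsNormalFormData (I J : Set ℝ) (f φ₀ φ₁ g : ℝ → ℝ) : Prop where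
  smooth_f : ContDiffOn ℝ ∞ f I
  smooth_φ₀ : ContDiffOn ℝ ∞ φ₀ I
  smooth_φ₁ : ContDiffOn ℝ ∞ φ₁ I
  smooth_g : ContDiffOn ℝ ∞ g J
  wronskian : ∀ x ∈ I, φ₀ x * deriv φ₁ x - φ₁ x * deriv φ₀ x = 1
  denom_ne_zero : ∀ x ∈ I, ∀ y ∈ J, deriv φ₁ x - y * deriv φ₀ x ≠ 0

/-! Write U = 1/A and V = 1/B. The definitions of θ₁ and θ₂ say exactly that dV = (V - U)θ₁ + V₂θ₂
and dU = U₁θ₁ + (U - V)θ₂ for some V₂, U₁ (`fderiv_inv_eq`). One device does the rest: a closed form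
has a local primitive (`exists_primitive_of_dForm_eq_zero`), and a function whose differential is a
multiple of du is a function of u (`exists_factor_of_fderiv_multiple`).

Write K for K₂. The equation for dK is what makes (2 - K)θ₁ + θ₂ closed; let L be a primitive. Then
e^L θ₁ is closed, which gives X with dX = e^L θ₁, and (1 - K)e^(-2L) has no θ₂-derivative, hence
equals μ(X). For any solution φ of φ'' + μφ = 0, the function P_φ = φ(X) - e^L φ'(X) satisfies dP_φ
= (1 - K)P_φ θ₁ - e^L φ'(X) θ₂. The θ₁-part is the same multiple of P_φ for all φ, so a quotient Y =
P_φ₁ / P_φ₀ has dY proportional to θ₂: this is the second coordinate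
(`hasFDerivAt_second_coordinate`).

With P = P_φ₀, d(dV) = 0 makes V₂P³e^(-2L) a function κ(Y) (`d_V₂`, `exists_curvature`). Choose g''
= κ. Then V + φ₀(X)g(Y) + e^L P⁻¹ g'(Y) has no θ₂-derivative (`hasFDerivAt_datum`), so it is f(X).
Since φ₁ - Yφ₀ = e^L/P and φ₁' - Yφ₀' = 1/P, this is the formula for V, and the θ₁-component of its
differential is the formula for U.

Each step is a closed quadrature, an algebraic operation or the one linear equation, so
computability is read off the construction (`byQuadratures_normalForm`). On θ₁ = 0 one has dL = θ₂,
so the integral w of θ₂ along these curves is L minus a function of X.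

Conversely, put N = φ₁ - yφ₀ and D = φ₁' - yφ₀'. The Wronskian makes V_x, U_y and V - U multiples of
one function R = f' - φ₀'g - Dg', namely R, R/D² and RN/D. Hence θ₁ = (D/N)dx and θ₂ = -dy/(DN), and
the structure equations follow with K = 1 - μ(N/D)². -/

open Filter Topology

/-! ### Functions smooth near a point -/

/-- `h` is smooth on a neighbourhood of `p`. -/
def SmoothNear {E F : Type*} [NormedAddCommGroup E] [NormedSpace ℝ E] [NormedAddCommGroup F]
    [NormedSpace ℝ F] (h : E → F) (p : E) : Prop :=
  ∀ᶠ q in 𝓝 p, ContDiffAt ℝ ∞ h q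

section SmoothNear

variable {E F G : Type*} [NormedAddCommGroup E] [NormedSpace ℝ E] [NormedAddCommGroup F]
  [NormedSpace ℝ F] [NormedAddCommGroup G] [NormedSpace ℝ G] {p : E}

theorem SmoothNear.self {h : E → F} (hh : SmoothNear h p) : ContDiffAt ℝ ∞ h p := hh.self_of_nhds

theorem SmoothNear.continuousAt {h : E → F} (hh : SmoothNear h p) : ContinuousAt h p :=
  hh.self.continuousAt

theorem SmoothNear.differentiableAt {h : E → F} (hh : SmoothNear h p) :
    ∀ᶠ q in 𝓝 p, DifferentiableAt ℝ h q :=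
  hh.mono fun _ hq => hq.differentiableAt (by simp)

theorem smoothNear_of_contDiffOn {h : E → F} {W : Set E} (hW : IsOpen W) (hp : p ∈ W)
    (hh : ContDiffOn ℝ ∞ h W) : SmoothNear h p :=
  (hW.mem_nhds hp |> fun hN => Filter.mem_of_superset hN fun q hq =>
    (hh q hq).contDiffAt (hW.mem_nhds hq))

theorem smoothNear_of_contDiff {h : E → F} (hh : ContDiff ℝ ∞ h) : SmoothNear h p :=
  Eventually.of_forall fun _ => hh.contDiffAt

theorem smoothNear_const (c : F) : SmoothNear (fun _ : E => c) p :=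
  smoothNear_of_contDiff contDiff_const

theorem SmoothNear.add {h k : E → F} (hh : SmoothNear h p) (hk : SmoothNear k p) :
    SmoothNear (fun q => h q + k q) p := by
  filter_upwards [hh, hk] with q h1 h2 using h1.add h2

theorem SmoothNear.sub {h k : E → F} (hh : SmoothNear h p) (hk : SmoothNear k p) :
    SmoothNear (fun q => h q - k q) p := by
  filter_upwards [hh, hk] with q h1 h2 using h1.sub h2

theorem SmoothNear.smul {h : E → ℝ} {k : E → F} (hh : SmoothNear h p) (hk : SmoothNear k p) :
    SmoothNear (fun q => h q • k q) p := by
  filter_upwards [hh, hk] with q h1 h2 using h1.smul h2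

theorem SmoothNear.mul {h k : E → ℝ} (hh : SmoothNear h p) (hk : SmoothNear k p) :
    SmoothNear (fun q => h q * k q) p := by
  filter_upwards [hh, hk] with q h1 h2 using h1.mul h2

theorem SmoothNear.inv {h : E → ℝ} (hh : SmoothNear h p) (h0 : h p ≠ 0) :
    SmoothNear (fun q => (h q)⁻¹) p := by
  filter_upwards [hh, hh.continuousAt.eventually_ne h0] with q h1 h2 using h1.inv h2

theorem SmoothNear.div {h k : E → ℝ} (hh : SmoothNear h p) (hk : SmoothNear k p)
    (h0 : k p ≠ 0) : SmoothNear (fun q => h q / k q) p := by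
  simpa only [div_eq_mul_inv] using hh.mul (hk.inv h0)

theorem SmoothNear.exp {h : E → ℝ} (hh : SmoothNear h p) :
    SmoothNear (fun q => Real.exp (h q)) p := by
  filter_upwards [hh] with q h1 using h1.exp

theorem SmoothNear.prodMk {h : E → F} {k : E → G} (hh : SmoothNear h p) (hk : SmoothNear k p) :
    SmoothNear (fun q => (h q, k q)) p := by
  filter_upwards [hh, hk] with q h1 h2 using h1.prodMk h2

theorem SmoothNear.comp {h : F → G} {k : E → F} (hh : SmoothNear h (k p))
    (hk : SmoothNear k p) : SmoothNear (fun q => h (k q)) p := by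
  filter_upwards [hk, hk.continuousAt.eventually hh] with q h1 h2 using h2.comp q h1

theorem SmoothNear.fderiv {h : E → F} (hh : SmoothNear h p) : SmoothNear (fderiv ℝ h) p := by
  filter_upwards [hh] with q h1 using h1.fderiv_right (m := ∞) (by simp)

theorem SmoothNear.clm_apply {h : E → F →L[ℝ] G} {k : E → F} (hh : SmoothNear h p)
    (hk : SmoothNear k p) : SmoothNear (fun q => h q (k q)) p := by
  filter_upwards [hh, hk] with q h1 h2 using h1.clm_apply h2

/-- A primitive is one order smoother than its derivative, so it inherits infinite smoothness. No
regularity has to be carried through the quadratures. -/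
theorem SmoothNear.of_hasFDerivAt {h : E → F} {σ : E → E →L[ℝ] F} (hσ : SmoothNear σ p)
    (hd : ∀ᶠ q in 𝓝 p, HasFDerivAt h (σ q) q) : SmoothNear h p := by
  obtain ⟨W, hW, hO, hp⟩ := eventually_nhds_iff.1 (hσ.and hd)
  refine smoothNear_of_contDiffOn hO hp ((contDiffOn_infty_iff_fderiv_of_isOpen hO).2
    ⟨fun q hq => (hW q hq).2.differentiableAt.differentiableWithinAt, fun q hq => ?_⟩)
  refine (hW q hq).1.contDiffWithinAt.congr (fun y hy => (hW y hy).2.fderiv) (hW q hq).2.fderiv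

theorem SmoothNear.of_hasDerivAt {h k : ℝ → ℝ} {s : ℝ} (hk : SmoothNear k s)
    (hd : ∀ᶠ q in 𝓝 s, HasDerivAt h (k q) q) : SmoothNear h s := by
  refine SmoothNear.of_hasFDerivAt
    (σ := fun q => ContinuousLinearMap.toSpanSingleton ℝ (k q)) ?_ (hd.mono fun q hq => hq.hasFDerivAt)
  exact SmoothNear.comp (h := fun c : ℝ => ContinuousLinearMap.toSpanSingleton ℝ c)
    (smoothNear_of_contDiff (ContinuousLinearMap.toSpanSingletonCLE (𝕜 := ℝ) (E := ℝ)).contDiff) hk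

end SmoothNear

/-! ### Primitives -/

theorem dForm_smul {k : Plane → ℝ} {σ : OneForm} {q : Plane} (hk : DifferentiableAt ℝ k q)
    (hσ : DifferentiableAt ℝ σ q) (v w : Plane) :
    dForm (fun q => k q • σ q) q v w =
      k q * dForm σ q v w + (fderiv ℝ k q v * σ q w - fderiv ℝ k q w * σ q v) := by
  unfold dForm
  rw [fderiv_fun_smul hk hσ]
  simp
  ring

theorem dForm_add {σ τ : OneForm} {q : Plane} (hσ : DifferentiableAt ℝ σ q)
    (hτ : DifferentiableAt ℝ τ q) (v w : Plane) :
    dForm (fun q => σ q + τ q) q v w = dForm σ q v w + dForm τ q v w := by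
  unfold dForm
  rw [fderiv_fun_add hσ hτ]
  simp
  ring

theorem dForm_congr {σ τ : OneForm} {q : Plane} (h : σ =ᶠ[𝓝 q] τ) (v w : Plane) :
    dForm σ q v w = dForm τ q v w := by
  unfold dForm
  rw [h.fderiv_eq]

theorem dForm_fderiv {h : Plane → ℝ} {q : Plane} (hh : ContDiffAt ℝ ∞ h q) (v w : Plane) :
    dForm (fderiv ℝ h) q v w = 0 := by
  have := (hh.isSymmSndFDerivAt (by
    simp only [minSmoothness_of_isRCLikeNormedField]; exact WithTop.coe_le_coe.2 (le_top : (2 : ℕ∞) ≤ ⊤))) v w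
  unfold dForm
  rw [this, sub_self]

/-- The Poincaré lemma on a ball, where convexity makes a form with symmetric derivative exact. -/
theorem exists_primitive_of_dForm_eq_zero {σ : OneForm} {p : Plane} (hσ : SmoothNear σ p)
    (hd : ∀ᶠ q in 𝓝 p, ∀ v w, dForm σ q v w = 0) :
    ∃ h : Plane → ℝ, h p = 0 ∧ SmoothNear h p ∧ ∀ᶠ q in 𝓝 p, HasFDerivAt h (σ q) q := by
  obtain ⟨ε, hε, hb⟩ := Metric.eventually_nhds_iff_ball.1 (hσ.and hd)
  obtain ⟨h, hh⟩ := (convex_ball p ε).exists_forall_hasFDerivAt_of_fderiv_symmetric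
    Metric.isOpen_ball
    (fun q hq => ((hb q hq).1.differentiableAt (by simp)).differentiableWithinAt)
    (fun q hq v w => sub_eq_zero.1 ((hb q hq).2 v w))
  have hd' : ∀ᶠ q in 𝓝 p, HasFDerivAt (fun q => h q - h p) (σ q) q :=
    Filter.mem_of_superset (Metric.ball_mem_nhds p hε) fun q hq => (hh q hq).sub_const _
  exact ⟨fun q => h q - h p, sub_self _, hσ.of_hasFDerivAt hd', hd'⟩

theorem exists_antideriv {k : ℝ → ℝ} {s : ℝ} (hk : SmoothNear k s) :
    ∃ h : ℝ → ℝ, SmoothNear h s ∧ ∀ᶠ t in 𝓝 s, HasDerivAt h (k t) t := by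
  obtain ⟨ε, hε, hb⟩ := Metric.eventually_nhds_iff_ball.1 hk
  obtain ⟨h, hh⟩ := (convex_ball s ε).exists_forall_hasDerivWithinAt
    (f := k) (fun q hq => ((hb q hq).differentiableAt (by simp)).differentiableWithinAt)
  have hd : ∀ᶠ t in 𝓝 s, HasDerivAt h (k t) t :=
    Filter.mem_of_superset (Metric.ball_mem_nhds s hε) fun t ht =>
      (hh t ht).hasDerivAt (Metric.isOpen_ball.mem_nhds ht)
  exact ⟨h, hk.of_hasDerivAt hd, hd⟩

/-! ### Local diffeomorphisms of the plane -/

/-- The inverse function theorem, shrunk to an open set on which the derivative stays invertible, so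
that the inverse is smooth at every point of its domain and not only at the image of `p`. -/
theorem exists_local_diffeomorph {F : Plane → Plane} {p : Plane} (hF : SmoothNear F p)
    (hinj : ∀ v, fderiv ℝ F p v = 0 → v = 0) {N : Set Plane} (hN : N ∈ 𝓝 p) :
    ∃ Φ : OpenPartialHomeomorph Plane Plane, p ∈ Φ.source ∧ Φ.source ⊆ N ∧ (Φ : Plane → Plane) = F ∧
      ContDiffOn ℝ ∞ Φ Φ.source ∧ ContDiffOn ℝ ∞ Φ.symm Φ.target := by
  have hinj' : Function.Injective (fderiv ℝ F p : Plane →ₗ[ℝ] Plane) :=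
    (injective_iff_map_eq_zero _).2 hinj
  let T : Plane ≃L[ℝ] Plane := (LinearEquiv.ofInjectiveEndo _ hinj').toContinuousLinearEquiv
  have hT : (T : Plane →L[ℝ] Plane) = fderiv ℝ F p := by ext <;> rfl
  have hTF : HasFDerivAt F (T : Plane →L[ℝ] Plane) p := by
    rw [hT]; exact (hF.self.differentiableAt (by simp)).hasFDerivAt
  have hinv : ∀ᶠ q in 𝓝 p, fderiv ℝ F q ∈ range ((↑) : (Plane ≃L[ℝ] Plane) → _) :=
    hF.fderiv.continuousAt.eventually_mem
      (ContinuousLinearEquiv.isOpen.mem_nhds ⟨T, hT⟩)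
  obtain ⟨O, hO, hOo, hpO⟩ := eventually_nhds_iff.1 ((hF.and hinv).and hN)
  refine ⟨(hF.self.toOpenPartialHomeomorph F hTF (by simp)).restrOpen O hOo,
    ⟨hF.self.mem_toOpenPartialHomeomorph_source hTF (by simp), hpO⟩,
    fun q hq => (hO q hq.2).2, rfl, fun q hq => (hO q hq.2).1.1.contDiffWithinAt, ?_⟩
  set Φ := (hF.self.toOpenPartialHomeomorph F hTF (by simp)).restrOpen O hOo with hΦ
  intro q hq
  have hq' : Φ.symm q ∈ O := (Φ.map_target hq).2
  obtain ⟨T', hT'⟩ := (hO _ hq').1.2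
  refine (Φ.contDiffAt_symm (f₀' := T') hq ?_ (hO _ hq').1.1).contDiffWithinAt
  rw [hT']
  exact ((hO _ hq').1.1.differentiableAt (by simp)).hasFDerivAt

/-- The preimage of a vertical segment has a velocity that `Φ` maps to (0, 1). This lies in the
kernel of the first component, so `h` has zero derivative along it. -/
theorem eq_of_fderiv_comp_eq_zero {Φ : OpenPartialHomeomorph Plane Plane}
    (hΦ : ContDiffOn ℝ ∞ Φ Φ.source) (hΦ' : ContDiffOn ℝ ∞ Φ.symm Φ.target) {h : Plane → ℝ}
    (hh : DifferentiableOn ℝ h Φ.source)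
    (hk : ∀ q ∈ Φ.source, ∀ v, (fderiv ℝ Φ q v).1 = 0 → fderiv ℝ h q v = 0)
    {I J : Set ℝ} (hI : I ×ˢ J ⊆ Φ.target) (hJo : IsOpen J) (hJ : IsPreconnected J)
    {s t t' : ℝ} (hs : s ∈ I) (ht : t ∈ J) (ht' : t' ∈ J) :
    h (Φ.symm (s, t)) = h (Φ.symm (s, t')) := by
  have key : ∀ t ∈ J, HasDerivAt (fun t => h (Φ.symm (s, t))) 0 t := by
    intro t ht
    have hm : (s, t) ∈ Φ.target := hI ⟨hs, ht⟩
    have hm' := Φ.map_target hm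
    have h1 : HasDerivAt (fun t : ℝ => ((s, t) : Plane)) (0, 1) t :=
      (hasDerivAt_const t s).prodMk (hasDerivAt_id t)
    have h2 : HasFDerivAt Φ.symm (fderiv ℝ Φ.symm (s, t)) (s, t) :=
      (((hΦ' _ hm).contDiffAt (Φ.open_target.mem_nhds hm)).differentiableAt (by simp)).hasFDerivAt
    have h3 : HasDerivAt (fun t => Φ.symm (s, t)) (fderiv ℝ Φ.symm (s, t) (0, 1)) t :=
      h2.comp_hasDerivAt t h1
    have h4 : HasFDerivAt Φ (fderiv ℝ Φ (Φ.symm (s, t))) (Φ.symm (s, t)) :=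
      (((hΦ _ hm').contDiffAt (Φ.open_source.mem_nhds hm')).differentiableAt (by simp)).hasFDerivAt
    have h5 := h4.comp_hasDerivAt t h3
    have h6 : HasDerivAt (fun t : ℝ => ((s, t) : Plane))
        (fderiv ℝ Φ (Φ.symm (s, t)) (fderiv ℝ Φ.symm (s, t) (0, 1))) t := by
      refine h5.congr_of_eventuallyEq ?_
      filter_upwards [hJo.mem_nhds ht] with t' ht'
      exact (Φ.right_inv (hI ⟨hs, ht'⟩)).symm
    have h7 := h6.unique h1
    have h8 := ((hh _ hm').differentiableAt (Φ.open_source.mem_nhds hm')).hasFDerivAt.comp_hasDerivAt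
      t h3
    rw [hk _ hm' _ (by rw [h7])] at h8
    exact h8
  exact hJo.is_const_of_deriv_eq_zero hJ
    (fun t ht => (key t ht).differentiableAt.differentiableWithinAt) (fun t ht => (key t ht).deriv)
    ht ht'

/-- A function whose differential is everywhere a multiple of `du` is a function of `u`. -/
theorem exists_factor_of_fderiv_multiple {u h : Plane → ℝ} {p : Plane} (hu : SmoothNear u p)
    (hh : SmoothNear h p) (hu0 : fderiv ℝ u p ≠ 0)
    (hd : ∀ᶠ q in 𝓝 p, ∀ v, fderiv ℝ u q v = 0 → fderiv ℝ h q v = 0) :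
    ∃ η : ℝ → ℝ, SmoothNear η (u p) ∧ ∀ᶠ q in 𝓝 p, h q = η (u q) := by
  set a := fderiv ℝ u p (1, 0) with ha
  set b := fderiv ℝ u p (0, 1) with hb
  have hlin : ∀ v : Plane, fderiv ℝ u p v = v.1 * a + v.2 * b := by
    intro v
    conv_lhs => rw [show v = v.1 • ((1, 0) : Plane) + v.2 • ((0, 1) : Plane) by ext <;> simp]
    rw [map_add, map_smul, map_smul]; rfl
  have hab : a ^ 2 + b ^ 2 ≠ 0 := by
    intro h0
    apply hu0
    have ha0 : a = 0 := by nlinarith [sq_nonneg a, sq_nonneg b]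
    have hb0 : b = 0 := by nlinarith [sq_nonneg a, sq_nonneg b]
    ext <;> simp [hlin, ha0, hb0]
  -- The differential of `u` at `p`, turned by a right angle: the Jacobian of (u, c) at `p` is a² +
  -- b².
  let c : Plane →L[ℝ] ℝ :=
    (-b) • ContinuousLinearMap.fst ℝ ℝ ℝ + a • ContinuousLinearMap.snd ℝ ℝ ℝ
  have hF : SmoothNear (fun q => (u q, c q)) p := hu.prodMk (smoothNear_of_contDiff c.contDiff)
  have hFd : ∀ q, DifferentiableAt ℝ u q →
      fderiv ℝ (fun q => (u q, c q)) q = (fderiv ℝ u q).prod c := fun q hq =>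
    (hq.hasFDerivAt.prodMk c.hasFDerivAt).fderiv
  obtain ⟨Φ, hpΦ, hsub, hΦF, hΦ, hΦ'⟩ := exists_local_diffeomorph hF (fun v hv => by
      rw [hFd p (hu.self.differentiableAt (by simp))] at hv
      have h1 : v.1 * a + v.2 * b = 0 := by rw [← hlin]; exact congrArg Prod.fst hv
      have h2 : -b * v.1 + a * v.2 = 0 := by simpa [c] using congrArg Prod.snd hv
      ext
      · apply mul_left_cancel₀ hab; simp only [Prod.fst_zero, mul_zero]; linear_combination a * h1 - b * h2
      · apply mul_left_cancel₀ hab; simp only [Prod.snd_zero, mul_zero]; linear_combination b * h1 + a * h2)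
    ((hu.and hh).and hd)
  have hΦp : Φ p = (u p, c p) := by rw [hΦF]
  have htar : (u p, c p) ∈ Φ.target := hΦp ▸ Φ.map_source hpΦ
  obtain ⟨ε, hε, hball⟩ := Metric.isOpen_iff.1 Φ.open_target _ htar
  rw [← ball_prod_same] at hball
  -- η is `h` restricted to the line `c = c p`, parametrized by `u`. On a box around the image of
  -- `p`, `h` does not depend on the second coordinate, so nothing is lost.
  refine ⟨fun s => h (Φ.symm (s, c p)), ?_, ?_⟩
  · filter_upwards [Metric.ball_mem_nhds (u p) hε] with s hs
    have hm : (s, c p) ∈ Φ.target := hball ⟨hs, Metric.mem_ball_self hε⟩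
    have h1 : ContDiffAt ℝ ∞ (fun s : ℝ => Φ.symm (s, c p)) s :=
      ContDiffAt.comp s ((hΦ' _ hm).contDiffAt (Φ.open_target.mem_nhds hm))
        (contDiffAt_id.prodMk contDiffAt_const)
    exact ContDiffAt.comp s (hsub (Φ.map_target hm)).1.2 h1
  · have hnear : ∀ᶠ q in 𝓝 p, Φ q ∈ Metric.ball (u p) ε ×ˢ Metric.ball (c p) ε := by
      refine (Φ.continuousAt hpΦ).eventually_mem ?_
      rw [hΦp]
      exact prod_mem_nhds (Metric.ball_mem_nhds _ hε) (Metric.ball_mem_nhds _ hε)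
    filter_upwards [hnear, Φ.open_source.mem_nhds hpΦ] with q hq hqs
    have hq2 : Φ q = (u q, c q) := by rw [hΦF]
    rw [hq2] at hq
    have := eq_of_fderiv_comp_eq_zero hΦ hΦ' (h := h)
      (fun q hq => ((hsub hq).1.2.differentiableAt (by simp)).differentiableWithinAt)
      (fun q hq v hv => (hsub hq).2 v (by
        rw [hΦF, hFd q ((hsub hq).1.1.differentiableAt (by simp))] at hv
        exact hv)) hball Metric.isOpen_ball (convex_ball _ _).isPreconnected hq.1 hq.2
        (Metric.mem_ball_self hε)
    rw [← this, ← hq2, Φ.left_inv hqs]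

/-! ### A linear second order equation -/

theorem exists_solution_linear_second_order {μ : ℝ → ℝ} {s₀ : ℝ} (hμ : SmoothNear μ s₀)
    (a b : ℝ) : ∃ φ ψ : ℝ → ℝ, φ s₀ = a ∧ ψ s₀ = b ∧ SmoothNear φ s₀ ∧ SmoothNear ψ s₀ ∧
      ∀ᶠ s in 𝓝 s₀, HasDerivAt φ (ψ s) s ∧ HasDerivAt ψ (-(μ s * φ s)) s := by
  -- Time is added as a first component, which makes the system autonomous; `htime` then identifies
  -- that component with the parameter.
  let X : ℝ × ℝ × ℝ → ℝ × ℝ × ℝ := fun z => (1, z.2.2, -(μ z.1 * z.2.1))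
  have hX : ContDiffAt ℝ 1 X (s₀, a, b) := by
    have h1 : ContDiffAt ℝ 1 (fun z : ℝ × ℝ × ℝ => μ z.1) (s₀, a, b) :=
      ContDiffAt.comp (s₀, a, b) (hμ.self.of_le (by simp)) contDiffAt_fst
    exact contDiffAt_const.prodMk ((contDiffAt_snd.snd).prodMk
      ((h1.mul contDiffAt_snd.fst).neg))
  obtain ⟨α, hα0, ε, hε, hα⟩ :=
    hX.exists_forall_mem_closedBall_exists_eq_forall_mem_Ioo_hasDerivAt₀ s₀
  obtain ⟨δ, hδ, hμδ⟩ := Metric.eventually_nhds_iff_ball.1 hμ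
  have hmem : s₀ ∈ Ioo (s₀ - ε) (s₀ + ε) := ⟨by linarith, by linarith⟩
  have htime : ∀ s ∈ Ioo (s₀ - ε) (s₀ + ε), (α s).1 = s := by
    intro s hs
    have hd : ∀ s ∈ Ioo (s₀ - ε) (s₀ + ε), HasDerivAt (fun s => (α s).1 - s) 0 s := fun s hs => by
      simpa [X] using (hasFDerivAt_fst.comp_hasDerivAt s (hα s hs)).fun_sub (hasDerivAt_id' s)
    have := isOpen_Ioo.is_const_of_deriv_eq_zero isPreconnected_Ioo
      (fun t ht => (hd t ht).differentiableAt.differentiableWithinAt) (fun t ht => (hd t ht).deriv)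
      hs hmem
    simp only [hα0, sub_self] at this
    linarith
  have hode : ∀ s ∈ Ioo (s₀ - ε) (s₀ + ε),
      HasDerivAt (fun s => (α s).2) ((α s).2.2, -(μ s * (α s).2.1)) s := fun s hs => by
    have := hasFDerivAt_snd.comp_hasDerivAt s (hα s hs)
    simp only [X, htime s hs] at this
    exact this
  -- Halving keeps the closed interval of radius ρ inside both the interval of existence and the
  -- ball where μ is smooth; the regularity theorem needs a closed interval.
  set ρ := min ε δ / 2 with hρ
  have hρ0 : 0 < ρ := by positivity
  have hρε : ρ < ε := by have := min_le_left ε δ; linarith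
  have hρδ : ρ < δ := by have := min_le_right ε δ; linarith
  have hsmooth : ContDiffOn ℝ ∞ (fun s => (α s).2) (Icc (s₀ - ρ) (s₀ + ρ)) := by
    refine ODE.contDiffOn_enat_Icc_of_hasDerivWithinAt (n := ⊤) (u := univ)
      (f := fun s z => (z.2, -(μ s * z.1))) ?_ ?_ (fun _ _ => mem_univ _)
    · rintro ⟨s, z⟩ ⟨hs, -⟩
      have h1 : ContDiffAt ℝ ∞ μ s := hμδ s (by
        rw [Real.ball_eq_Ioo]; exact ⟨by linarith [hs.1], by linarith [hs.2]⟩)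
      have h2 : ContDiffAt ℝ ∞ (fun z : ℝ × ℝ × ℝ => μ z.1) (s, z) :=
        ContDiffAt.comp (s, z) h1 contDiffAt_fst
      exact ((contDiffAt_snd.snd).prodMk ((h2.mul contDiffAt_snd.fst).neg)).contDiffWithinAt
    · intro s hs
      exact (hode s ⟨by linarith [hs.1], by linarith [hs.2]⟩).hasDerivWithinAt
  have hnear : ∀ᶠ s in 𝓝 s₀, s ∈ Ioo (s₀ - ρ) (s₀ + ρ) :=
    Ioo_mem_nhds (by linarith) (by linarith)
  have hsm : ∀ᶠ s in 𝓝 s₀, ContDiffAt ℝ ∞ (fun s => (α s).2) s := hnear.mono fun s hs =>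
    (hsmooth s (Ioo_subset_Icc_self hs)).contDiffAt (Icc_mem_nhds hs.1 hs.2)
  refine ⟨fun s => (α s).2.1, fun s => (α s).2.2, by simp [hα0], by simp [hα0],
    hsm.mono fun s hs => hs.fst, hsm.mono fun s hs => hs.snd, hnear.mono fun s hs => ?_⟩
  have h := hode s ⟨by linarith [hs.1], by linarith [hs.2]⟩
  have h1 : HasFDerivAt (Prod.fst : ℝ × ℝ → ℝ) (ContinuousLinearMap.fst ℝ ℝ ℝ) (α s).2 :=
    hasFDerivAt_fst
  have h2 : HasFDerivAt (Prod.snd : ℝ × ℝ → ℝ) (ContinuousLinearMap.snd ℝ ℝ ℝ) (α s).2 :=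
    hasFDerivAt_snd
  have h3 : HasDerivAt (fun s => (α s).2.1) _ s := h1.comp_hasDerivAt s h
  have h4 : HasDerivAt (fun s => (α s).2.2) _ s := h2.comp_hasDerivAt s h
  exact ⟨h3, h4⟩

/-! ### The normal form of a Type I coframing near a point -/

/-- Near `p`, the coframing `θ₁`, `θ₂` satisfies the Type I structure equations with the function
`K`, and `U`, `V` are the inverse eigenvalues of an operator with that coframing, where
`V₂` is the coefficient of `θ₂` in `dV`. -/
structure IsTypeIGerm (p : Plane) (θ₁ θ₂ : OneForm) (K U V V₂ : Plane → ℝ) : Prop where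
  smooth_θ₁ : SmoothNear θ₁ p
  smooth_θ₂ : SmoothNear θ₂ p
  smooth_K : SmoothNear K p
  smooth_U : SmoothNear U p
  smooth_V : SmoothNear V p
  smooth_V₂ : SmoothNear V₂ p
  frame : ∀ᶠ q in 𝓝 p, ∃ v w, θ₁ q v = 1 ∧ θ₁ q w = 0 ∧ θ₂ q v = 0 ∧ θ₂ q w = 1
  d_θ₁ : ∀ᶠ q in 𝓝 p, ∀ v w, dForm θ₁ q v w = wedge θ₁ θ₂ q v w
  d_θ₂ : ∀ᶠ q in 𝓝 p, ∀ v w, dForm θ₂ q v w = K q * wedge θ₂ θ₁ q v w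
  d_K : ∀ᶠ q in 𝓝 p, ∃ k : ℝ, fderiv ℝ K q = k • θ₁ q + (2 * (K q - 1)) • θ₂ q
  d_U : ∀ᶠ q in 𝓝 p, ∃ u : ℝ, fderiv ℝ U q = u • θ₁ q + (U q - V q) • θ₂ q
  d_V : ∀ᶠ q in 𝓝 p, fderiv ℝ V q = (V q - U q) • θ₁ q + V₂ q • θ₂ q

namespace IsTypeIGerm

variable {p : Plane} {θ₁ θ₂ : OneForm} {K U V V₂ : Plane → ℝ}

/-- The coefficient 2(K - 1) of θ₂ in dK is what makes this form closed: -dK ∧ θ₁ contributes 2(K -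
1) θ₁ ∧ θ₂, which cancels the (2 - 2K) θ₁ ∧ θ₂ coming from dθ₁ and dθ₂. -/
theorem exists_log_factor (h : IsTypeIGerm p θ₁ θ₂ K U V V₂) :
    ∃ L : Plane → ℝ, SmoothNear L p ∧
      ∀ᶠ q in 𝓝 p, HasFDerivAt L ((2 - K q) • θ₁ q + θ₂ q) q := by
  have h2 : SmoothNear (fun q => 2 - K q) p := (smoothNear_const 2).sub h.smooth_K
  obtain ⟨L, -, hL, hd⟩ := exists_primitive_of_dForm_eq_zero
    (σ := fun q => (2 - K q) • θ₁ q + θ₂ q) ((h2.smul h.smooth_θ₁).add h.smooth_θ₂) (by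
      filter_upwards [h2.differentiableAt, h.smooth_K.differentiableAt, h.smooth_θ₁.differentiableAt,
        h.smooth_θ₂.differentiableAt, h.d_θ₁, h.d_θ₂, h.d_K] with q hk hK h1 h2 hd1 hd2 hdK v w
      obtain ⟨k, hk'⟩ := hdK
      rw [dForm_add (hk.fun_smul h1) h2, dForm_smul hk h1, hd1, hd2, fderiv_const_sub, hk']
      simp [wedge]
      ring)
  exact ⟨L, hL, hd⟩

/-- e^L is an integrating factor: dL ∧ θ₁ = θ₂ ∧ θ₁ cancels dθ₁. -/
theorem exists_first_coordinate (h : IsTypeIGerm p θ₁ θ₂ K U V V₂) {L : Plane → ℝ}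
    (hL : SmoothNear L p) (hLd : ∀ᶠ q in 𝓝 p, HasFDerivAt L ((2 - K q) • θ₁ q + θ₂ q) q) :
    ∃ X : Plane → ℝ, X p = 0 ∧ SmoothNear X p ∧
      ∀ᶠ q in 𝓝 p, HasFDerivAt X (Real.exp (L q) • θ₁ q) q := by
  refine exists_primitive_of_dForm_eq_zero (hL.exp.smul h.smooth_θ₁) ?_
  filter_upwards [hL.exp.differentiableAt, h.smooth_θ₁.differentiableAt, hLd, h.d_θ₁]
    with q he h1 hLq hd1 v w
  rw [dForm_smul he h1, hd1, hLq.exp.fderiv]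
  simp [wedge]
  ring

theorem eq_of_frame (h : IsTypeIGerm p θ₁ θ₂ K U V V₂) : θ₁ p ≠ 0 ∧ θ₂ p ≠ 0 := by
  obtain ⟨v, w, h1, h2, h3, h4⟩ := h.frame.self_of_nhds
  exact ⟨fun h0 => by simp [h0] at h1, fun h0 => by simp [h0] at h4⟩

/-- Along θ₁ = 0 one has d(1 - K) = 2(1 - K)θ₂ and d(-2L) = -2θ₂, so the product is constant there.
This produces the potential of the linear equation before that equation is solved. -/
theorem exists_potential (h : IsTypeIGerm p θ₁ θ₂ K U V V₂) {L X : Plane → ℝ}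
    (hL : SmoothNear L p) (hLd : ∀ᶠ q in 𝓝 p, HasFDerivAt L ((2 - K q) • θ₁ q + θ₂ q) q)
    (hX : SmoothNear X p) (hXd : ∀ᶠ q in 𝓝 p, HasFDerivAt X (Real.exp (L q) • θ₁ q) q) :
    ∃ μ : ℝ → ℝ, SmoothNear μ (X p) ∧
      ∀ᶠ q in 𝓝 p, (1 - K q) * Real.exp (-2 * L q) = μ (X q) := by
  refine exists_factor_of_fderiv_multiple hX
    (((smoothNear_const 1).sub h.smooth_K).mul ((smoothNear_const (-2)).mul hL).exp) ?_ ?_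
  · rw [hXd.self_of_nhds.fderiv]
    exact smul_ne_zero (Real.exp_ne_zero _) h.eq_of_frame.1
  · filter_upwards [h.smooth_K.differentiableAt, hLd, hXd, h.d_K] with q hK hLq hXq hdK v hv
    obtain ⟨k, hk⟩ := hdK
    rw [hXq.fderiv] at hv
    have hv' : θ₁ q v = 0 := by simpa [Real.exp_ne_zero] using hv
    have hd := ((hK.hasFDerivAt.const_sub 1).fun_mul (hLq.const_mul (-2)).exp)
    rw [hd.fderiv, hk]
    simp [hv']
    ring

theorem hasFDerivAt_second_coordinate {L X : Plane → ℝ}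
    {φ₀ φ₁ ψ₀ ψ₁ μ : ℝ → ℝ}
    (hLd : ∀ᶠ q in 𝓝 p, HasFDerivAt L ((2 - K q) • θ₁ q + θ₂ q) q)
    (hXd : ∀ᶠ q in 𝓝 p, HasFDerivAt X (Real.exp (L q) • θ₁ q) q)
    (hμ : ∀ᶠ q in 𝓝 p, (1 - K q) * Real.exp (-2 * L q) = μ (X q))
    (h₀ : ∀ᶠ q in 𝓝 p, HasDerivAt φ₀ (ψ₀ (X q)) (X q) ∧
      HasDerivAt ψ₀ (-(μ (X q) * φ₀ (X q))) (X q))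
    (h₁ : ∀ᶠ q in 𝓝 p, HasDerivAt φ₁ (ψ₁ (X q)) (X q) ∧
      HasDerivAt ψ₁ (-(μ (X q) * φ₁ (X q))) (X q))
    (hw : ∀ᶠ q in 𝓝 p, φ₀ (X q) * ψ₁ (X q) - φ₁ (X q) * ψ₀ (X q) = 1)
    (hP : ∀ᶠ q in 𝓝 p, φ₀ (X q) - Real.exp (L q) * ψ₀ (X q) ≠ 0) :
    (∀ᶠ q in 𝓝 p, HasFDerivAt (fun q => φ₀ (X q) - Real.exp (L q) * ψ₀ (X q))
        (((1 - K q) * (φ₀ (X q) - Real.exp (L q) * ψ₀ (X q))) • θ₁ q -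
          (Real.exp (L q) * ψ₀ (X q)) • θ₂ q) q) ∧
    ∀ᶠ q in 𝓝 p, HasFDerivAt
      (fun q => (φ₁ (X q) - Real.exp (L q) * ψ₁ (X q)) * (φ₀ (X q) - Real.exp (L q) * ψ₀ (X q))⁻¹)
      ((-(Real.exp (L q) * ((φ₀ (X q) - Real.exp (L q) * ψ₀ (X q)) ^ 2)⁻¹)) • θ₂ q) q := by
  -- Valid for every solution. The θ₁-part is (1 - K) times the function itself, which drops out of
  -- the quotient of two solutions; the Wronskian then evaluates the θ₂-part.
  have key : ∀ {φ ψ : ℝ → ℝ}, (∀ᶠ q in 𝓝 p, HasDerivAt φ (ψ (X q)) (X q) ∧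
      HasDerivAt ψ (-(μ (X q) * φ (X q))) (X q)) → ∀ᶠ q in 𝓝 p,
      HasFDerivAt (fun q => φ (X q) - Real.exp (L q) * ψ (X q))
        (((1 - K q) * (φ (X q) - Real.exp (L q) * ψ (X q))) • θ₁ q -
          (Real.exp (L q) * ψ (X q)) • θ₂ q) q := by
    intro φ ψ hφ
    filter_upwards [hLd, hXd, hμ, hφ] with q hLq hXq hμq hφq
    have hd := (hφq.1.comp_hasFDerivAt q hXq).fun_sub
      (hLq.exp.fun_mul (hφq.2.comp_hasFDerivAt q hXq))
    refine hd.congr_fderiv ?_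
    have hm : μ (X q) * Real.exp (L q) * Real.exp (L q) = 1 - K q := by
      rw [← hμq, mul_assoc, mul_assoc, ← Real.exp_add, ← Real.exp_add]
      simp [← two_mul]
    refine ContinuousLinearMap.ext fun z => ?_
    simp
    linear_combination (φ (X q) * θ₁ q z) * hm
  constructor
  · exact key h₀
  · filter_upwards [key h₀, key h₁, hP, hw] with q hq₀ hq₁ hPq hwq
    have hd := hq₁.fun_mul ((hasDerivAt_inv hPq).comp_hasFDerivAt q hq₀)
    refine hd.congr_fderiv ?_
    refine ContinuousLinearMap.ext fun z => ?_
    simp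
    field_simp
    linear_combination (-Real.exp (L q) * θ₂ q z) * hwq

/-- This is the θ₁ ∧ θ₂ component of d(dV) = 0, isolated by pairing with the frame vector on which
θ₁ = 0 and θ₂ = 1. The unknown θ₁-derivative of U does not enter. -/
theorem d_V₂ (h : IsTypeIGerm p θ₁ θ₂ K U V V₂) :
    ∀ᶠ q in 𝓝 p, ∀ v, θ₂ q v = 0 → fderiv ℝ V₂ q v = (1 + K q) * V₂ q * θ₁ q v := by
  filter_upwards [h.smooth_V, h.smooth_U.differentiableAt, h.smooth_V.differentiableAt,
    h.smooth_V₂.differentiableAt, h.smooth_θ₁.differentiableAt, h.smooth_θ₂.differentiableAt,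
    h.frame, h.d_θ₁, h.d_θ₂, h.d_U, eventually_eventually_nhds.2 h.d_V]
    with q hVs hU hV hV₂ h1 h2 hfr hd1 hd2 hdU hdV v hv
  obtain ⟨_, w, -, hw1, -, hw2⟩ := hfr
  obtain ⟨u, hu⟩ := hdU
  have h0 := dForm_congr hdV v w
  rw [dForm_fderiv hVs, dForm_add ((hV.fun_sub hU).fun_smul h1) (hV₂.fun_smul h2),
    dForm_smul (hV.fun_sub hU) h1, dForm_smul hV₂ h2, hd1, hd2, fderiv_fun_sub hV hU,
    hdV.self_of_nhds, hu] at h0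
  simp [wedge, hv, hw1, hw2] at h0
  linear_combination -h0

/-- Along θ₂ = 0 the logarithmic derivatives of V₂, P³ and e^(-2L) are 1 + K, 3(1 - K) and -2(2 - K)
times θ₁, with sum zero. The exponents 3 and -2 are chosen for this. -/
theorem exists_curvature (h : IsTypeIGerm p θ₁ θ₂ K U V V₂) {L P Y : Plane → ℝ}
    {b : Plane → ℝ} {ψ : Plane → ℝ} (hL : SmoothNear L p)
    (hLd : ∀ᶠ q in 𝓝 p, HasFDerivAt L ((2 - K q) • θ₁ q + θ₂ q) q)
    (hP : SmoothNear P p)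
    (hPd : ∀ᶠ q in 𝓝 p, HasFDerivAt P (((1 - K q) * P q) • θ₁ q - ψ q • θ₂ q) q)
    (hY : SmoothNear Y p) (hYd : ∀ᶠ q in 𝓝 p, HasFDerivAt Y (b q • θ₂ q) q)
    (hb : ∀ᶠ q in 𝓝 p, b q ≠ 0) :
    ∃ κ : ℝ → ℝ, SmoothNear κ (Y p) ∧
      ∀ᶠ q in 𝓝 p, V₂ q * P q ^ 3 * Real.exp (-2 * L q) = κ (Y q) := by
  have hP3 : SmoothNear (fun q => P q ^ 3) p := by
    filter_upwards [hP] with q hq using hq.pow 3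
  refine exists_factor_of_fderiv_multiple hY
    ((h.smooth_V₂.mul hP3).mul ((smoothNear_const (-2)).mul hL).exp) ?_ ?_
  · rw [hYd.self_of_nhds.fderiv]
    exact smul_ne_zero hb.self_of_nhds h.eq_of_frame.2
  · filter_upwards [h.smooth_V₂.differentiableAt, hLd, hPd, hYd, hb, h.d_V₂]
      with q hV₂ hLq hPq hYq hbq hdV v hv
    rw [hYq.fderiv] at hv
    have hv' : θ₂ q v = 0 := by simpa [hbq] using hv
    have hd := (hV₂.hasFDerivAt.fun_mul (hPq.pow 3)).fun_mul (hLq.const_mul (-2)).exp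
    rw [hd.fderiv]
    simp [hv', hdV v hv']
    ring

/-- The equation g'' = κ is imposed in order to cancel V₂θ₂; the terms in g'(Y)θ₂ cancel by the
definition of P. What is left is a multiple of θ₁, hence of dX. -/
theorem hasFDerivAt_datum {L X Y P : Plane → ℝ} {φ₀ ψ₀ g g₁ κ : ℝ → ℝ}
    (hV : ∀ᶠ q in 𝓝 p, HasFDerivAt V ((V q - U q) • θ₁ q + V₂ q • θ₂ q) q)
    (hLd : ∀ᶠ q in 𝓝 p, HasFDerivAt L ((2 - K q) • θ₁ q + θ₂ q) q)
    (hXd : ∀ᶠ q in 𝓝 p, HasFDerivAt X (Real.exp (L q) • θ₁ q) q)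
    (hPe : ∀ᶠ q in 𝓝 p, P q = φ₀ (X q) - Real.exp (L q) * ψ₀ (X q))
    (hP0 : ∀ᶠ q in 𝓝 p, P q ≠ 0)
    (hPd : ∀ᶠ q in 𝓝 p, HasFDerivAt P
      (((1 - K q) * P q) • θ₁ q - (Real.exp (L q) * ψ₀ (X q)) • θ₂ q) q)
    (hYd : ∀ᶠ q in 𝓝 p, HasFDerivAt Y ((-(Real.exp (L q) * (P q ^ 2)⁻¹)) • θ₂ q) q)
    (h₀ : ∀ᶠ q in 𝓝 p, HasDerivAt φ₀ (ψ₀ (X q)) (X q))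
    (hg : ∀ᶠ q in 𝓝 p, HasDerivAt g (g₁ (Y q)) (Y q) ∧ HasDerivAt g₁ (κ (Y q)) (Y q))
    (hκ : ∀ᶠ q in 𝓝 p, V₂ q * P q ^ 3 * Real.exp (-2 * L q) = κ (Y q)) :
    ∀ᶠ q in 𝓝 p, HasFDerivAt
      (fun q => V q + φ₀ (X q) * g (Y q) + Real.exp (L q) * (P q)⁻¹ * g₁ (Y q))
      ((V q - U q + Real.exp (L q) * (ψ₀ (X q) * g (Y q) + (P q)⁻¹ * g₁ (Y q))) • θ₁ q) q := by
  filter_upwards [hV, hLd, hXd, hPe, hP0, hPd, hYd, h₀, hg, hκ]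
    with q hVq hLq hXq hPeq hP0q hPq hYq h₀q hgq hκq
  have hd := (hVq.fun_add ((h₀q.comp_hasFDerivAt q hXq).fun_mul
    (hgq.1.comp_hasFDerivAt q hYq))).fun_add
    ((hLq.exp.fun_mul ((hasDerivAt_inv hP0q).comp_hasFDerivAt q hPq)).fun_mul
      (hgq.2.comp_hasFDerivAt q hYq))
  refine hd.congr_fderiv ?_
  have hk : κ (Y q) * (Real.exp (L q) * Real.exp (L q)) = V₂ q * P q ^ 3 := by
    rw [← hκq, mul_assoc, ← Real.exp_add, ← Real.exp_add]
    simp [← two_mul]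
  refine ContinuousLinearMap.ext fun z => ?_
  simp
  field_simp
  linear_combination (-(θ₂ q z)) * hk +
    (P q * Real.exp (L q) * g₁ (Y q) * θ₂ q z) * hPeq

end IsTypeIGerm

/-- Near `p`, the functions `X`, `Y` are coordinates in which an operator with the inverse
eigenvalues `U`, `V` and the coframing `θ₁`, `θ₂` has the explicit normal form with the data
`f`, `φ₀`, `φ₁`, `g`. The derivatives of `φ₀`, `φ₁`, `g` are `ψ₀`, `ψ₁`, `g₁`, and `L` is the
logarithm of the factor `dX / θ₁`. -/
structure IsNormalFormGerm (p : Plane) (θ₁ θ₂ : OneForm) (K U V V₂ L X Y : Plane → ℝ)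
    (f φ₀ φ₁ ψ₀ ψ₁ g g₁ κ μ : ℝ → ℝ) : Prop where
  smooth_L : SmoothNear L p
  smooth_X : SmoothNear X p
  smooth_Y : SmoothNear Y p
  smooth_f : SmoothNear f (X p)
  smooth_φ₀ : SmoothNear φ₀ (X p)
  smooth_φ₁ : SmoothNear φ₁ (X p)
  smooth_μ : SmoothNear μ (X p)
  smooth_g : SmoothNear g (Y p)
  d_L : ∀ᶠ q in 𝓝 p, HasFDerivAt L ((2 - K q) • θ₁ q + θ₂ q) q
  d_X : ∀ᶠ q in 𝓝 p, HasFDerivAt X (Real.exp (L q) • θ₁ q) q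
  d_Y : ∀ᶠ q in 𝓝 p, HasFDerivAt Y
    ((-(Real.exp (L q) * ((φ₀ (X q) - Real.exp (L q) * ψ₀ (X q)) ^ 2)⁻¹)) • θ₂ q) q
  eq_Y : ∀ q, Y q =
    (φ₁ (X q) - Real.exp (L q) * ψ₁ (X q)) * (φ₀ (X q) - Real.exp (L q) * ψ₀ (X q))⁻¹
  denom_ne_zero : ∀ᶠ q in 𝓝 p, φ₀ (X q) - Real.exp (L q) * ψ₀ (X q) ≠ 0
  eq_μ : ∀ᶠ q in 𝓝 p, (1 - K q) * Real.exp (-2 * L q) = μ (X q)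
  d_φ₀ : ∀ᶠ s in 𝓝 (X p), HasDerivAt φ₀ (ψ₀ s) s ∧ HasDerivAt ψ₀ (-(μ s * φ₀ s)) s
  d_φ₁ : ∀ᶠ s in 𝓝 (X p), HasDerivAt φ₁ (ψ₁ s) s ∧ HasDerivAt ψ₁ (-(μ s * φ₁ s)) s
  wronskian : ∀ᶠ s in 𝓝 (X p), φ₀ s * ψ₁ s - φ₁ s * ψ₀ s = 1
  d_g : ∀ᶠ t in 𝓝 (Y p), HasDerivAt g (g₁ t) t ∧ HasDerivAt g₁ (κ t) t
  eq_κ : ∀ᶠ q in 𝓝 p, V₂ q * (φ₀ (X q) - Real.exp (L q) * ψ₀ (X q)) ^ 3 *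
    Real.exp (-2 * L q) = κ (Y q)
  eq_f : ∀ᶠ q in 𝓝 p, V q + φ₀ (X q) * g (Y q) +
    Real.exp (L q) * (φ₀ (X q) - Real.exp (L q) * ψ₀ (X q))⁻¹ * g₁ (Y q) = f (X q)
  eq_U : ∀ᶠ q in 𝓝 p, U q = explicitU f φ₀ φ₁ g (X q, Y q)
  eq_V : ∀ᶠ q in 𝓝 p, V q = explicitV f φ₀ φ₁ g (X q, Y q)

/-! ### Assembly of the normal form germ -/

theorem wronskian_eq_one {φ₀ φ₁ ψ₀ ψ₁ μ : ℝ → ℝ} {s₀ : ℝ}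
    (h₀ : ∀ᶠ s in 𝓝 s₀, HasDerivAt φ₀ (ψ₀ s) s ∧ HasDerivAt ψ₀ (-(μ s * φ₀ s)) s)
    (h₁ : ∀ᶠ s in 𝓝 s₀, HasDerivAt φ₁ (ψ₁ s) s ∧ HasDerivAt ψ₁ (-(μ s * φ₁ s)) s)
    (hs : φ₀ s₀ * ψ₁ s₀ - φ₁ s₀ * ψ₀ s₀ = 1) :
    ∀ᶠ s in 𝓝 s₀, φ₀ s * ψ₁ s - φ₁ s * ψ₀ s = 1 := by
  obtain ⟨ε, hε, hb⟩ := Metric.eventually_nhds_iff_ball.1 (h₀.and h₁)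
  have hd : ∀ s ∈ Metric.ball s₀ ε, HasDerivAt (fun s => φ₀ s * ψ₁ s - φ₁ s * ψ₀ s) 0 s := by
    intro s hs
    obtain ⟨⟨a, b⟩, c, d⟩ := hb s hs
    exact ((a.fun_mul d).fun_sub (c.fun_mul b)).congr_deriv (by ring)
  filter_upwards [Metric.ball_mem_nhds s₀ hε] with s hs'
  rw [← hs]
  exact Metric.isOpen_ball.is_const_of_deriv_eq_zero (convex_ball s₀ ε).isPreconnected
    (fun t ht => (hd t ht).differentiableAt.differentiableWithinAt) (fun t ht => (hd t ht).deriv)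
    hs' (Metric.mem_ball_self hε)

theorem IsTypeIGerm.exists_normalForm {p : Plane} {θ₁ θ₂ : OneForm} {K U V V₂ : Plane → ℝ}
    (h : IsTypeIGerm p θ₁ θ₂ K U V V₂) :
    ∃ (L X Y : Plane → ℝ) (f φ₀ φ₁ ψ₀ ψ₁ g g₁ κ μ : ℝ → ℝ),
      IsNormalFormGerm p θ₁ θ₂ K U V V₂ L X Y f φ₀ φ₁ ψ₀ ψ₁ g g₁ κ μ := by
  obtain ⟨L, hL, hLd⟩ := h.exists_log_factor
  obtain ⟨X, -, hX, hXd⟩ := h.exists_first_coordinate hL hLd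
  obtain ⟨μ, hμ, hμe⟩ := h.exists_potential hL hLd hX hXd
  -- The initial values (1, 0) and (0, 1) give Wronskian 1, and also P(p) = 1 whatever L(p) is, so
  -- that Y is defined near `p`.
  obtain ⟨φ₀, ψ₀, hφ₀p, hψ₀p, hφ₀, hψ₀, hd₀⟩ := exists_solution_linear_second_order hμ 1 0
  obtain ⟨φ₁, ψ₁, hφ₁p, hψ₁p, hφ₁, hψ₁, hd₁⟩ := exists_solution_linear_second_order hμ 0 1
  have hw := wronskian_eq_one hd₀ hd₁ (by rw [hφ₀p, hψ₀p, hψ₁p]; ring)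
  have hXc := hX.continuousAt
  set P : Plane → ℝ := fun q => φ₀ (X q) - Real.exp (L q) * ψ₀ (X q) with hPdef
  have hP : SmoothNear P p := (hφ₀.comp hX).sub (hL.exp.mul (hψ₀.comp hX))
  have hPp : P p = 1 := by simp [hPdef, hφ₀p, hψ₀p]
  have hP0 : ∀ᶠ q in 𝓝 p, P q ≠ 0 := hP.continuousAt.eventually_ne (by rw [hPp]; exact one_ne_zero)
  obtain ⟨hPd, hYd⟩ := hasFDerivAt_second_coordinate hLd hXd hμe (hXc.eventually hd₀)
    (hXc.eventually hd₁) (hXc.eventually hw) hP0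
  set Y : Plane → ℝ := fun q => (φ₁ (X q) - Real.exp (L q) * ψ₁ (X q)) *
    (φ₀ (X q) - Real.exp (L q) * ψ₀ (X q))⁻¹ with hYdef
  have hY : SmoothNear Y p :=
    ((hφ₁.comp hX).sub (hL.exp.mul (hψ₁.comp hX))).mul (hP.inv (by rw [hPp]; exact one_ne_zero))
  have hYc := hY.continuousAt
  obtain ⟨κ, hκ, hκe⟩ := h.exists_curvature hL hLd hP hPd hY hYd
    (hP0.mono fun q hq => neg_ne_zero.2
      (mul_ne_zero (Real.exp_ne_zero _) (inv_ne_zero (pow_ne_zero 2 hq))))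
  obtain ⟨g₁, hg₁, hg₁d⟩ := exists_antideriv hκ
  obtain ⟨g, hg, hgd⟩ := exists_antideriv hg₁
  have hVd : ∀ᶠ q in 𝓝 p, HasFDerivAt V ((V q - U q) • θ₁ q + V₂ q • θ₂ q) q := by
    filter_upwards [h.smooth_V.differentiableAt, h.d_V] with q h1 h2
    rw [← h2]; exact h1.hasFDerivAt
  have hfd := hasFDerivAt_datum hVd hLd hXd (Eventually.of_forall fun _ => rfl) hP0 hPd hYd
    (hXc.eventually (hd₀.mono fun _ hs => hs.1)) (hYc.eventually (hgd.and hg₁d)) hκe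
  obtain ⟨f, hf, hfe⟩ := exists_factor_of_fderiv_multiple hX
    ((h.smooth_V.add ((hφ₀.comp hX).mul (hg.comp hY))).add
      ((hL.exp.mul (hP.inv (by rw [hPp]; exact one_ne_zero))).mul (hg₁.comp hY)))
    (by rw [hXd.self_of_nhds.fderiv]; exact smul_ne_zero (Real.exp_ne_zero _) h.eq_of_frame.1)
    (by
      filter_upwards [hXd, hfd] with q hXq hfq v hv
      rw [hXq.fderiv] at hv
      have hv' : θ₁ q v = 0 := by simpa [Real.exp_ne_zero] using hv
      rw [hfq.fderiv]
      simp [hv'])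
  -- Two expressions for the differential of f(X), compared on the frame vector with θ₁ = 1. The
  -- equation gives U in terms of V and f'.
  have hf' : ∀ᶠ q in 𝓝 p, V q - U q + Real.exp (L q) * (ψ₀ (X q) * g (Y q) + (P q)⁻¹ * g₁ (Y q))
      = Real.exp (L q) * deriv f (X q) := by
    filter_upwards [hXd, hfd, hXc.eventually hf.differentiableAt, eventually_eventually_nhds.2 hfe,
      h.frame] with q hXq hfq hfX hfeq hfr
    obtain ⟨v, w, hv, -⟩ := hfr
    have h1 := (hfX.hasDerivAt.comp_hasFDerivAt q hXq).congr_of_eventuallyEq hfeq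
    have h2 := DFunLike.congr_fun (hfq.unique h1) v
    simp [hv] at h2
    linear_combination h2
  -- The Wronskian turns the denominator of the explicit formulas into 1/P and the pencil φ₁ - Yφ₀
  -- into e^L/P.
  have halg : ∀ᶠ q in 𝓝 p, deriv φ₀ (X q) = ψ₀ (X q) ∧ deriv φ₁ (X q) = ψ₁ (X q) ∧
      deriv g (Y q) = g₁ (Y q) ∧ ψ₁ (X q) - Y q * ψ₀ (X q) = (P q)⁻¹ ∧
      φ₁ (X q) - Y q * φ₀ (X q) = Real.exp (L q) * (P q)⁻¹ := by
    filter_upwards [hXc.eventually hd₀, hXc.eventually hd₁, hYc.eventually hgd, hXc.eventually hw,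
      hP0] with q h1 h2 h3 h4 h5
    refine ⟨h1.1.deriv, h2.1.deriv, h3.deriv, ?_, ?_⟩
    · simp only [hYdef]
      change ψ₁ (X q) - (φ₁ (X q) - Real.exp (L q) * ψ₁ (X q)) * (P q)⁻¹ * ψ₀ (X q) = (P q)⁻¹
      field_simp
      simp only [hPdef]
      linear_combination h4
    · change φ₁ (X q) - (φ₁ (X q) - Real.exp (L q) * ψ₁ (X q)) * (P q)⁻¹ * φ₀ (X q) =
        Real.exp (L q) * (P q)⁻¹
      field_simp
      simp only [hPdef]
      linear_combination Real.exp (L q) * h4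
  refine ⟨L, X, Y, f, φ₀, φ₁, ψ₀, ψ₁, g, g₁, κ, μ, hL, hX, hY, hf, hφ₀, hφ₁, hμ, hg, hLd, hXd, hYd,
    fun _ => rfl, hP0, hμe, hd₀, hd₁, hw, hgd.and hg₁d, hκe, hfe, ?_, ?_⟩
  · filter_upwards [hfe, hf', halg, hP0] with q h1 h2 h3 h8
    obtain ⟨h3, h4, h5, h6, h7⟩ := h3
    simp only [explicitU]
    rw [h3, h4, h6, h7, ← h1]
    have he := mul_inv_cancel₀ (Real.exp_ne_zero (L q))
    have h9 : deriv f (X q) = (V q - U q) * (Real.exp (L q))⁻¹ +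
        (ψ₀ (X q) * g (Y q) + (P q)⁻¹ * g₁ (Y q)) := by
      linear_combination -(Real.exp (L q))⁻¹ * h2 -
        (deriv f (X q) - (ψ₀ (X q) * g (Y q) + (P q)⁻¹ * g₁ (Y q))) * he
    rw [h9]
    rw [mul_div_cancel_right₀ _ (inv_ne_zero h8), div_inv_eq_mul]
    have hPq : P q = φ₀ (X q) - Real.exp (L q) * ψ₀ (X q) := rfl
    linear_combination (V q - U q) * he + g (Y q) * hPq
  · filter_upwards [hfe, halg] with q h1 h3
    obtain ⟨h3, h4, h5, h6, h7⟩ := h3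
    simp only [explicitV]
    rw [h5, h7, ← h1]
    ring

/-! ### Linear algebra in the plane -/

theorem clm_apply_plane {F : Type*} [NormedAddCommGroup F] [NormedSpace ℝ F] (T : Plane →L[ℝ] F)
    (v : Plane) : T v = v.1 • T (1, 0) + v.2 • T (0, 1) := by
  conv_lhs => rw [show v = v.1 • ((1, 0) : Plane) + v.2 • ((0, 1) : Plane) by ext <;> simp]
  rw [map_add, map_smul, map_smul]

theorem charpoly_eq_zero_of_hasEigenvalue {T : Plane →L[ℝ] Plane} {a : ℝ}
    (h : Module.End.HasEigenvalue (T : Plane →ₗ[ℝ] Plane) a) :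
    ((T (1, 0)).1 - a) * ((T (0, 1)).2 - a) - (T (0, 1)).1 * (T (1, 0)).2 = 0 := by
  obtain ⟨v, hv⟩ := h.exists_hasEigenvector
  have h1 : T v = a • v := hv.apply_eq_smul
  rw [clm_apply_plane] at h1
  have e1 := congrArg Prod.fst h1
  have e2 := congrArg Prod.snd h1
  simp only [Prod.fst_add, Prod.snd_add, Prod.smul_fst, Prod.smul_snd, smul_eq_mul] at e1 e2
  by_contra hne
  apply hv.2
  ext
  · apply mul_left_cancel₀ hne
    simp only [Prod.fst_zero, mul_zero]
    linear_combination ((T (0, 1)).2 - a) * e1 - (T (0, 1)).1 * e2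
  · apply mul_left_cancel₀ hne
    simp only [Prod.snd_zero, mul_zero]
    linear_combination ((T (1, 0)).1 - a) * e2 - (T (1, 0)).2 * e1

/-- Vieta: two distinct roots of a monic quadratic determine its coefficients. -/
theorem trace_det_of_hasEigenvalue {T : Plane →L[ℝ] Plane} {a b : ℝ} (hab : a ≠ b)
    (ha : Module.End.HasEigenvalue (T : Plane →ₗ[ℝ] Plane) a)
    (hb : Module.End.HasEigenvalue (T : Plane →ₗ[ℝ] Plane) b) :
    (T (1, 0)).1 + (T (0, 1)).2 = a + b ∧
      (T (1, 0)).1 * (T (0, 1)).2 - (T (0, 1)).1 * (T (1, 0)).2 = a * b := by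
  have h1 := charpoly_eq_zero_of_hasEigenvalue ha
  have h2 := charpoly_eq_zero_of_hasEigenvalue hb
  have h3 : (T (1, 0)).1 + (T (0, 1)).2 = a + b := by
    apply mul_left_cancel₀ (sub_ne_zero.2 hab)
    linear_combination h2 - h1
  exact ⟨h3, by linear_combination h1 + a * h3⟩

theorem apply_apply_of_hasEigenvalue {T : Plane →L[ℝ] Plane} {a b : ℝ} (hab : a ≠ b)
    (ha : Module.End.HasEigenvalue (T : Plane →ₗ[ℝ] Plane) a)
    (hb : Module.End.HasEigenvalue (T : Plane →ₗ[ℝ] Plane) b) (v : Plane) :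
    T (T v) = (a + b) • T v - (a * b) • v := by
  obtain ⟨h1, h2⟩ := trace_det_of_hasEigenvalue hab ha hb
  rw [← h1, ← h2, clm_apply_plane T (T v), clm_apply_plane T v]
  ext <;> simp <;> ring

theorem eq_of_wedge_ne_zero {σ τ : OneForm} {q : Plane} (h : wedge σ τ q (1, 0) (0, 1) ≠ 0)
    (η : Plane →L[ℝ] ℝ) :
    η = ((η (1, 0) * τ q (0, 1) - η (0, 1) * τ q (1, 0)) / wedge σ τ q (1, 0) (0, 1)) • σ q +
      ((η (0, 1) * σ q (1, 0) - η (1, 0) * σ q (0, 1)) / wedge σ τ q (1, 0) (0, 1)) • τ q := by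
  refine ContinuousLinearMap.ext fun z => ?_
  rw [clm_apply_plane η z, add_apply, smul_apply,
    smul_apply, clm_apply_plane (σ q) z, clm_apply_plane (τ q) z]
  simp only [smul_eq_mul]
  field_simp
  simp only [wedge]
  ring

theorem wedge_ne_zero_of_frame {σ τ : OneForm} {q v w : Plane} (h : wedge σ τ q v w ≠ 0) :
    wedge σ τ q (1, 0) (0, 1) ≠ 0 := by
  intro h0
  apply h
  simp only [wedge] at h0 ⊢
  rw [clm_apply_plane (σ q) v, clm_apply_plane (σ q) w, clm_apply_plane (τ q) v,
    clm_apply_plane (τ q) w]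
  simp only [smul_eq_mul]
  linear_combination (v.1 * w.2 - v.2 * w.1) * h0

/-! ### The coframing of an operator -/

namespace IsInvertibleNondegenerateOn

variable {W : Set Plane} {S : OperatorField} {A B : Plane → ℝ}

/-- Invertibility and nondegeneracy are symmetric in the two eigenvalues, and `theta2` is by
definition `theta1` with the eigenvalues exchanged. Each statement about θ₁ thus yields the one
about θ₂; only the Type I equations break the symmetry. -/
theorem swap (h : IsInvertibleNondegenerateOn W S A B) : IsInvertibleNondegenerateOn W S B A where
  smooth_S := h.smooth_S
  smooth_A := h.smooth_B
  smooth_B := h.smooth_A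
  eigen_A := h.eigen_B
  eigen_B := h.eigen_A
  A_ne_B q hq := (h.A_ne_B q hq).symm
  A_ne_zero := h.B_ne_zero
  B_ne_zero := h.A_ne_zero
  dDoublePrime_A_ne_zero := h.dPrime_B_ne_zero
  dPrime_B_ne_zero := h.dDoublePrime_A_ne_zero

theorem eigenProj_apply_eq (h : IsInvertibleNondegenerateOn W S A B) {q : Plane} (hq : q ∈ W)
    (z : Plane) : eigenProj S A B q (S q z) = A q • eigenProj S A B q z := by
  simp only [eigenProj, smul_apply, sub_apply,
    ContinuousLinearMap.id_apply]
  rw [apply_apply_of_hasEigenvalue (h.A_ne_B q hq) (h.eigen_A q hq) (h.eigen_B q hq)]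
  module

theorem apply_eigenProj_eq (h : IsInvertibleNondegenerateOn W S A B) {q : Plane} (hq : q ∈ W)
    (z : Plane) : S q (eigenProj S A B q z) = A q • eigenProj S A B q z := by
  rw [← h.eigenProj_apply_eq hq]
  simp [eigenProj]

theorem theta1_apply_eq (h : IsInvertibleNondegenerateOn W S A B) {q : Plane} (hq : q ∈ W)
    (z : Plane) : theta1 S A B q (S q z) = A q * theta1 S A B q z := by
  simp only [theta1, dPrime, smul_apply, ContinuousLinearMap.comp_apply,
    h.eigenProj_apply_eq hq, map_smul, smul_eq_mul]
  ring

theorem theta2_eq_theta1_swap (S : OperatorField) (A B : Plane → ℝ) :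
    theta2 S A B = theta1 S B A := rfl

theorem theta2_apply_eq (h : IsInvertibleNondegenerateOn W S A B) {q : Plane} (hq : q ∈ W)
    (z : Plane) : theta2 S A B q (S q z) = B q * theta2 S A B q z :=
  h.swap.theta1_apply_eq hq z

theorem eigenProj_of_eigenvector (h : IsInvertibleNondegenerateOn W S A B) {q : Plane} (hq : q ∈ W)
    {v : Plane} (hv : S q v = A q • v) : eigenProj S A B q v = v := by
  have := sub_ne_zero.2 (h.A_ne_B q hq)
  simp only [eigenProj, smul_apply, sub_apply,
    ContinuousLinearMap.id_apply, hv]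
  rw [← sub_smul, smul_smul, inv_mul_cancel₀ this, one_smul]

theorem exists_eigenvector (h : IsInvertibleNondegenerateOn W S A B) {q : Plane} (hq : q ∈ W) :
    ∃ v, S q v = A q • v ∧ theta1 S A B q v = 1 ∧ theta2 S A B q v = 0 := by
  have hA := h.A_ne_zero q hq
  have hB := h.B_ne_zero q hq
  have hAB := sub_ne_zero.2 (h.A_ne_B q hq).symm
  obtain ⟨z, hz⟩ : ∃ z, dPrime S A B B q z ≠ 0 := by
    by_contra! hcon
    exact h.dPrime_B_ne_zero q hq (ContinuousLinearMap.ext hcon)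
  -- Projecting a vector detected by d'B gives an A-eigenvector with θ₁ nonzero. θ₂ is a covector of
  -- eigenvalue B, so it kills this vector.
  set v := eigenProj S A B q z with hv
  have hSv : S q v = A q • v := h.apply_eigenProj_eq hq z
  have h1 : theta1 S A B q v ≠ 0 := by
    have : theta1 S A B q v = A q / (B q * (B q - A q)) * dPrime S A B B q z := by
      simp only [theta1, dPrime, smul_apply, ContinuousLinearMap.comp_apply,
        smul_eq_mul]
      rw [h.eigenProj_of_eigenvector hq hSv]
    rw [this]
    exact mul_ne_zero (div_ne_zero hA (mul_ne_zero hB hAB)) hz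
  have h2 : theta2 S A B q v = 0 := by
    have := h.theta2_apply_eq hq v
    rw [hSv, map_smul, smul_eq_mul] at this
    have h3 : (A q - B q) * theta2 S A B q v = 0 := by linear_combination this
    exact (mul_eq_zero.1 h3).resolve_left (sub_ne_zero.2 (h.A_ne_B q hq))
  refine ⟨(theta1 S A B q v)⁻¹ • v, by rw [map_smul, hSv, smul_comm], ?_, ?_⟩
  · rw [map_smul, smul_eq_mul, inv_mul_cancel₀ h1]
  · rw [map_smul, h2, smul_zero]

theorem exists_frame (h : IsInvertibleNondegenerateOn W S A B) {q : Plane} (hq : q ∈ W) :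
    ∃ v w, theta1 S A B q v = 1 ∧ theta1 S A B q w = 0 ∧ theta2 S A B q v = 0 ∧
      theta2 S A B q w = 1 := by
  obtain ⟨v, -, h1, h2⟩ := h.exists_eigenvector hq
  obtain ⟨w, -, h3, h4⟩ := h.swap.exists_eigenvector hq
  exact ⟨v, w, h1, h4, h2, h3⟩

theorem wedge_ne_zero (h : IsInvertibleNondegenerateOn W S A B) {q : Plane} (hq : q ∈ W) :
    wedge (theta1 S A B) (theta2 S A B) q (1, 0) (0, 1) ≠ 0 := by
  obtain ⟨v, w, h1, h2, h3, h4⟩ := h.exists_frame hq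
  refine wedge_ne_zero_of_frame (v := v) (w := w) ?_
  simp [wedge, h1, h2, h3, h4]

theorem smooth_eigenProj (h : IsInvertibleNondegenerateOn W S A B) :
    ContDiffOn ℝ ∞ (eigenProj S A B) W :=
  ((h.smooth_A.sub h.smooth_B).inv fun q hq => sub_ne_zero.2 (h.A_ne_B q hq)).smul
    (h.smooth_S.sub (h.smooth_B.smul contDiffOn_const))

theorem smooth_theta1 (h : IsInvertibleNondegenerateOn W S A B) (hW : IsOpen W) :
    ContDiffOn ℝ ∞ (theta1 S A B) W :=
  (h.smooth_A.div (h.smooth_B.mul (h.smooth_B.sub h.smooth_A)) fun q hq =>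
    mul_ne_zero (h.B_ne_zero q hq) (sub_ne_zero.2 (h.A_ne_B q hq).symm)).smul
    ((h.smooth_B.fderiv_of_isOpen hW (by simp)).clm_comp h.smooth_eigenProj)

/-- The differential of the inverse of the second eigenvalue. -/
theorem fderiv_inv_eq (h : IsInvertibleNondegenerateOn W S A B) (hW : IsOpen W) {q : Plane}
    (hq : q ∈ W) : fderiv ℝ (fun q => (B q)⁻¹) q = ((B q)⁻¹ - (A q)⁻¹) • theta1 S A B q +
      ((fderiv ℝ (fun q => (B q)⁻¹) q (0, 1) * theta1 S A B q (1, 0) -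
        fderiv ℝ (fun q => (B q)⁻¹) q (1, 0) * theta1 S A B q (0, 1)) /
        wedge (theta1 S A B) (theta2 S A B) q (1, 0) (0, 1)) • theta2 S A B q := by
  have hA := h.A_ne_zero q hq
  have hB := h.B_ne_zero q hq
  have hAB := sub_ne_zero.2 (h.A_ne_B q hq).symm
  have hdB : HasFDerivAt B (fderiv ℝ B q) q :=
    ((h.smooth_B.contDiffAt (hW.mem_nhds hq)).differentiableAt (by simp)).hasFDerivAt
  -- The θ₁-coefficient is found by evaluating on an A-eigenvector dual to θ₁; the θ₂-coefficient is
  -- left in Cramer form, which is what the computability argument uses.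
  obtain ⟨v, hSv, h1, h2⟩ := h.exists_eigenvector hq
  have hv : fderiv ℝ (fun q => (B q)⁻¹) q v = (B q)⁻¹ - (A q)⁻¹ := by
    have hd : fderiv ℝ (fun q => (B q)⁻¹) q = -(B q ^ 2)⁻¹ • fderiv ℝ B q :=
      ((hasDerivAt_inv hB).comp_hasFDerivAt q hdB).fderiv
    rw [hd]
    simp only [theta1, dPrime, smul_apply, ContinuousLinearMap.comp_apply,
      h.eigenProj_of_eigenvector hq hSv, smul_eq_mul] at h1 ⊢
    field_simp at h1 ⊢
    linear_combination -h1
  conv_lhs => rw [eq_of_wedge_ne_zero (h.wedge_ne_zero hq) (fderiv ℝ (fun q => (B q)⁻¹) q)]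
  congr 2
  have := DFunLike.congr_fun (eq_of_wedge_ne_zero (h.wedge_ne_zero hq)
    (fderiv ℝ (fun q => (B q)⁻¹) q)) v
  simp only [add_apply, smul_apply, h1, h2, hv,
    smul_eq_mul, mul_one, mul_zero, add_zero] at this
  exact this.symm

end IsInvertibleNondegenerateOn

/-- The coefficient of the second form of the coframing in the differential of the inverse of the
second eigenvalue. -/
noncomputable def invEigenvalueCoeff (S : OperatorField) (A B : Plane → ℝ) (q : Plane) : ℝ :=
  (fderiv ℝ (fun q => (B q)⁻¹) q (0, 1) * theta1 S A B q (1, 0) -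
    fderiv ℝ (fun q => (B q)⁻¹) q (1, 0) * theta1 S A B q (0, 1)) /
    wedge (theta1 S A B) (theta2 S A B) q (1, 0) (0, 1)

/-- A single K serves all points of `W`; its formula through dθ₂ is kept apart because it exhibits K
as computable from the coframing. -/
theorem IsTypeIOn.isTypeIGerm {W : Set Plane} {S : OperatorField} {A B : Plane → ℝ}
    (h : IsTypeIOn W S A B) (hW : IsOpen W) :
    ∃ K : Plane → ℝ, (∀ q ∈ W, ∀ v w, dForm (theta2 S A B) q v w =
        K q * wedge (theta2 S A B) (theta1 S A B) q v w) ∧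
      ∀ p ∈ W, IsTypeIGerm p (theta1 S A B) (theta2 S A B) K (fun q => (A q)⁻¹)
        (fun q => (B q)⁻¹) (invEigenvalueCoeff S A B) := by
  obtain ⟨h, K, K₁, hK, hE⟩ := h
  refine ⟨K, fun q hq => (hE q hq).2.1, fun p hp => ?_⟩
  have hWp : ∀ᶠ q in 𝓝 p, q ∈ W := hW.mem_nhds hp
  have h1 := smoothNear_of_contDiffOn hW hp (h.smooth_theta1 hW)
  have h2 : SmoothNear (theta2 S A B) p :=
    smoothNear_of_contDiffOn hW hp (h.swap.smooth_theta1 hW)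
  have hV := smoothNear_of_contDiffOn hW hp (h.smooth_B.inv h.B_ne_zero)
  have hc : ∀ {σ : OneForm}, SmoothNear σ p → ∀ v, SmoothNear (fun q => σ q v) p :=
    fun hσ v => hσ.clm_apply (smoothNear_const v)
  refine ⟨h1, h2, smoothNear_of_contDiffOn hW hp hK,
    smoothNear_of_contDiffOn hW hp (h.smooth_A.inv h.A_ne_zero), hV, ?_,
    hWp.mono fun q hq => h.exists_frame hq, hWp.mono fun q hq => (hE q hq).1,
    hWp.mono fun q hq => (hE q hq).2.1, hWp.mono fun q hq => ⟨_, (hE q hq).2.2⟩, ?_,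
    hWp.mono fun q hq => h.fderiv_inv_eq hW hq⟩
  · refine SmoothNear.div (((hc hV.fderiv _).mul (hc h1 _)).sub ((hc hV.fderiv _).mul (hc h1 _)))
      ?_ (h.wedge_ne_zero hp)
    exact ((hc h1 _).mul (hc h2 _)).sub ((hc h1 _).mul (hc h2 _))
  · filter_upwards [hWp] with q hq
    refine ⟨_, (h.swap.fderiv_inv_eq hW hq).trans (add_comm _ _)⟩

/-! ### Computability -/

namespace ByQuadratures

variable {W : Set Plane} {G : Set (Plane → ℝ)}

/-- Substitution: functions computed from computable functions are computable. -/
theorem trans {G' : Set (Plane → ℝ)} (hG : ∀ k ∈ G, ByQuadratures W G' k) {h : Plane → ℝ}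
    (hh : ByQuadratures W G h) : ByQuadratures W G' h := by
  induction hh with
  | given h hG₀ => exact hG h hG₀
  | congr h k _ heq ih => exact .congr h k ih heq
  | const c => exact .const c
  | add h k _ _ ih₁ ih₂ => exact .add h k ih₁ ih₂
  | mul h k _ _ ih₁ ih₂ => exact .mul h k ih₁ ih₂
  | inv h _ h0 ih => exact .inv h ih h0
  | root n c h _ hcont hroot hsimple ih => exact .root n c h ih hcont hroot hsimple
  | exp h _ ih => exact .exp h ih
  | partial₁ h _ ih => exact .partial₁ h ih
  | partial₂ h _ ih => exact .partial₂ h ih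
  | quadrature h hd _ _ ih₁ ih₂ => exact .quadrature h hd ih₁ ih₂

theorem mono {G' : Set (Plane → ℝ)} (hG : G ⊆ G') {h : Plane → ℝ} (hh : ByQuadratures W G h) :
    ByQuadratures W G' h :=
  hh.trans fun k hk => .given k (hG hk)

theorem neg {h : Plane → ℝ} (hh : ByQuadratures W G h) : ByQuadratures W G (fun q => -h q) :=
  .congr _ _ (.mul _ _ (.const (-1)) hh) fun q _ => by ring

theorem sub {h k : Plane → ℝ} (hh : ByQuadratures W G h) (hk : ByQuadratures W G k) :
    ByQuadratures W G (fun q => h q - k q) :=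
  .congr _ _ (.add _ _ hh hk.neg) fun q _ => by ring

theorem div {h k : Plane → ℝ} (hh : ByQuadratures W G h) (hk : ByQuadratures W G k)
    (h0 : ∀ q ∈ W, k q ≠ 0) : ByQuadratures W G (fun q => h q / k q) :=
  .congr _ _ (.mul _ _ hh (.inv _ hk h0)) fun q _ => by rw [div_eq_mul_inv]

theorem pow {h : Plane → ℝ} (hh : ByQuadratures W G h) (n : ℕ) :
    ByQuadratures W G (fun q => h q ^ n) := by
  induction n with
  | zero => exact .congr _ _ (.const 1) fun q _ => by simp
  | succ n ih => exact .congr _ _ (.mul _ _ ih hh) fun q _ => by rw [pow_succ]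

theorem fderiv_apply {h : Plane → ℝ} (hh : ByQuadratures W G h) {v : Plane → Plane}
    (hv₁ : ByQuadratures W G fun q => (v q).1) (hv₂ : ByQuadratures W G fun q => (v q).2) :
    ByQuadratures W G (fun q => fderiv ℝ h q (v q)) :=
  .congr _ _ (.add _ _ (.mul _ _ hv₁ (.partial₁ _ hh)) (.mul _ _ hv₂ (.partial₂ _ hh)))
    fun q _ => by rw [clm_apply_plane]; rfl

theorem of_hasFDerivAt {h : Plane → ℝ} {σ : OneForm} (hd : ∀ q ∈ W, HasFDerivAt h (σ q) q)
    (h₁ : ByQuadratures W G fun q => σ q (1, 0)) (h₂ : ByQuadratures W G fun q => σ q (0, 1)) :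
    ByQuadratures W G h :=
  .quadrature h (fun q hq => (hd q hq).differentiableAt.differentiableWithinAt)
    (.congr _ _ h₁ fun q hq => by rw [(hd q hq).fderiv])
    (.congr _ _ h₂ fun q hq => by rw [(hd q hq).fderiv])

/-- The gradient of φ ∘ X is ψ(X) times that of X. Pairing with the gradient of X and dividing by
its squared length avoids dividing by a single partial derivative, which might vanish somewhere. -/
theorem deriv_comp {X : Plane → ℝ} {φ ψ : ℝ → ℝ} (hX : ByQuadratures W G X)
    (hφ : ByQuadratures W G (φ ∘ X)) (hXd : ∀ q ∈ W, DifferentiableAt ℝ X q)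
    (hX0 : ∀ q ∈ W, fderiv ℝ X q ≠ 0) (hd : ∀ q ∈ W, HasDerivAt φ (ψ (X q)) (X q)) :
    ByQuadratures W G (ψ ∘ X) := by
  have h0 : ∀ q ∈ W, fderiv ℝ X q (1, 0) ^ 2 + fderiv ℝ X q (0, 1) ^ 2 ≠ 0 := by
    intro q hq h
    apply hX0 q hq
    refine ContinuousLinearMap.ext fun v => ?_
    have h1 : fderiv ℝ X q (1, 0) = 0 := by
      nlinarith [sq_nonneg (fderiv ℝ X q (1, 0)), sq_nonneg (fderiv ℝ X q (0, 1))]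
    have h2 : fderiv ℝ X q (0, 1) = 0 := by
      nlinarith [sq_nonneg (fderiv ℝ X q (1, 0)), sq_nonneg (fderiv ℝ X q (0, 1))]
    rw [clm_apply_plane, h1, h2]
    simp
  refine .congr _ _ (div (.add _ _ (.mul _ _ (.partial₁ _ hX) (.partial₁ _ hφ))
    (.mul _ _ (.partial₂ _ hX) (.partial₂ _ hφ))) (.add _ _ (pow (.partial₁ _ hX) 2)
    (pow (.partial₂ _ hX) 2)) h0) fun q hq => ?_
  have h1 : fderiv ℝ (φ ∘ X) q = ψ (X q) • fderiv ℝ X q :=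
    ((hd q hq).comp_hasFDerivAt q (hXd q hq).hasFDerivAt).fderiv
  rw [eq_div_iff (h0 q hq), h1]
  simp only [smul_apply, smul_eq_mul, Function.comp_apply]
  ring

end ByQuadratures

/-! ### Quadratures for the coframing and the normal form -/

section Computability

variable {W : Set Plane} {S : OperatorField} {A B : Plane → ℝ} {G : Set (Plane → ℝ)}

theorem byQuadratures_affine (σ : Plane →L[ℝ] ℝ) (p : Plane) :
    ByQuadratures W G (fun q => σ (q - p)) :=
  .of_hasFDerivAt (σ := fun _ => σ)
    (fun q _ => σ.hasFDerivAt.comp q ((hasFDerivAt_id q).sub_const p)) (.const _) (.const _)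

namespace IsInvertibleNondegenerateOn

theorem byQuadratures_entries : ByQuadratures W (entries S) (fun q => (S q (1, 0)).1) ∧
    ByQuadratures W (entries S) (fun q => (S q (0, 1)).1) ∧
    ByQuadratures W (entries S) (fun q => (S q (1, 0)).2) ∧
    ByQuadratures W (entries S) (fun q => (S q (0, 1)).2) :=
  ⟨.given _ (by simp [entries]), .given _ (by simp [entries]), .given _ (by simp [entries]),
    .given _ (by simp [entries])⟩

theorem byQuadratures_eigenvalue (h : IsInvertibleNondegenerateOn W S A B) :
    ByQuadratures W (entries S) A := by
  obtain ⟨h11, h12, h21, h22⟩ := byQuadratures_entries (W := W) (S := S)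
  have htd : ∀ q ∈ W, _ := fun q hq =>
    trace_det_of_hasEigenvalue (h.A_ne_B q hq) (h.eigen_A q hq) (h.eigen_B q hq)
  -- The characteristic polynomial: determinant at index 0, minus the trace at index 1, leading
  -- coefficient 1. Its derivative at A is A - B, so the root is simple.
  refine .root 2 (fun i q => if i = 0 then (S q (1, 0)).1 * (S q (0, 1)).2 -
    (S q (0, 1)).1 * (S q (1, 0)).2 else if i = 1 then -((S q (1, 0)).1 + (S q (0, 1)).2) else 1) A
    (fun i => ?_) h.smooth_A.continuousOn (fun q hq => ?_) (fun q hq => ?_)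
  · by_cases h0 : i = 0
    · simpa [h0] using (ByQuadratures.mul _ _ h11 h22).sub (.mul _ _ h12 h21)
    · by_cases h1 : i = 1
      · simpa [h1] using (ByQuadratures.add _ _ h11 h22).neg
      · simpa [h0, h1] using .const 1
  · obtain ⟨h1, h2⟩ := htd q hq
    simp only [Finset.sum_range_succ, Finset.sum_range_zero]
    simp [h1, h2]
    ring
  · obtain ⟨h1, h2⟩ := htd q hq
    simp only [Finset.sum_range_succ, Finset.sum_range_zero]
    simp [h1]
    intro h3
    exact h.A_ne_B q hq (by linarith)

theorem byQuadratures_theta1 (h : IsInvertibleNondegenerateOn W S A B) :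
    ByQuadratures W (entries S) (fun q => theta1 S A B q (1, 0)) ∧
      ByQuadratures W (entries S) (fun q => theta1 S A B q (0, 1)) := by
  obtain ⟨h11, h12, h21, h22⟩ := byQuadratures_entries (W := W) (S := S)
  have hA := h.byQuadratures_eigenvalue
  have hB := h.swap.byQuadratures_eigenvalue
  have hc : ByQuadratures W (entries S) (fun q => A q / (B q * (B q - A q))) :=
    hA.div (.mul _ _ hB (hB.sub hA)) fun q hq =>
      mul_ne_zero (h.B_ne_zero q hq) (sub_ne_zero.2 (h.A_ne_B q hq).symm)
  have hi : ByQuadratures W (entries S) (fun q => (A q - B q)⁻¹) :=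
    .inv _ (hA.sub hB) fun q hq => sub_ne_zero.2 (h.A_ne_B q hq)
  constructor
  · refine .mul _ _ hc (hB.fderiv_apply (v := fun q => eigenProj S A B q (1, 0)) ?_ ?_)
    · exact .congr _ _ (.mul _ _ hi (h11.sub hB)) fun q _ => by simp [eigenProj]
    · exact .congr _ _ (.mul _ _ hi h21) fun q _ => by simp [eigenProj]
  · refine .mul _ _ hc (hB.fderiv_apply (v := fun q => eigenProj S A B q (0, 1)) ?_ ?_)
    · exact .congr _ _ (.mul _ _ hi h12) fun q _ => by simp [eigenProj]
    · exact .congr _ _ (.mul _ _ hi (h22.sub hB)) fun q _ => by simp [eigenProj]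

theorem byQuadratures_curvature (h : IsInvertibleNondegenerateOn W S A B) (hW : IsOpen W)
    {K : Plane → ℝ} (hK : ∀ q ∈ W, ∀ v w, dForm (theta2 S A B) q v w =
        K q * wedge (theta2 S A B) (theta1 S A B) q v w) : ByQuadratures W (entries S) K := by
  obtain ⟨h1, h2⟩ := h.byQuadratures_theta1
  obtain ⟨h3, h4⟩ := h.swap.byQuadratures_theta1
  rw [← theta2_eq_theta1_swap] at h3 h4
  have h0 : ∀ q ∈ W, wedge (theta2 S A B) (theta1 S A B) q (1, 0) (0, 1) ≠ 0 := fun q hq =>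
    h.swap.wedge_ne_zero hq
  refine .congr _ _ (ByQuadratures.div ((ByQuadratures.partial₁ _ h4).sub (.partial₂ _ h3))
    ((ByQuadratures.mul _ _ h3 h2).sub (.mul _ _ h4 h1)) h0) fun q hq => ?_
  have hd : DifferentiableAt ℝ (theta2 S A B) q :=
    ((h.swap.smooth_theta1 hW).contDiffAt (hW.mem_nhds hq)).differentiableAt (by simp)
  have he : ∀ v w, fderiv ℝ (fun q => theta2 S A B q v) q w = fderiv ℝ (theta2 S A B) q w v := by
    intro v w
    rw [fderiv_clm_apply hd (differentiableAt_const v)]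
    simp
  rw [he, he]
  exact eq_div_of_mul_eq (h0 q hq) (hK q hq _ _).symm

theorem byQuadratures_invEigenvalueCoeff (h : IsInvertibleNondegenerateOn W S A B) :
    ByQuadratures W (entries S) (invEigenvalueCoeff S A B) := by
  obtain ⟨h1, h2⟩ := h.byQuadratures_theta1
  obtain ⟨h3, h4⟩ := h.swap.byQuadratures_theta1
  rw [← theta2_eq_theta1_swap] at h3 h4
  have hV := ByQuadratures.inv _ h.swap.byQuadratures_eigenvalue h.B_ne_zero
  exact ByQuadratures.div ((ByQuadratures.mul _ _ (.partial₂ _ hV) h1).sub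
    (.mul _ _ (.partial₁ _ hV) h2)) ((ByQuadratures.mul _ _ h1 h4).sub (.mul _ _ h2 h3))
    fun q hq => h.wedge_ne_zero hq

variable {K U L X Y : Plane → ℝ} {f φ₀ φ₁ ψ₀ ψ₁ g g₁ κ μ : ℝ → ℝ}

/-- L, X and μ ∘ X need only the entries of the operator. The solutions φ₀, φ₁ enter afterwards;
their derivatives come from differentiation in the plane, and g from two quadratures of κ(Y)dY and
g'(Y)dY. -/
theorem byQuadratures_normalForm (h : IsInvertibleNondegenerateOn W S A B) (hW : IsOpen W)
    (hK : ∀ q ∈ W, ∀ v w, dForm (theta2 S A B) q v w =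
      K q * wedge (theta2 S A B) (theta1 S A B) q v w)
    (hN : ∀ q ∈ W, IsNormalFormGerm q (theta1 S A B) (theta2 S A B) K U (fun q => (B q)⁻¹)
      (invEigenvalueCoeff S A B) L X Y f φ₀ φ₁ ψ₀ ψ₁ g g₁ κ μ) :
    ByQuadratures W (entries S) X ∧ ByQuadratures W (entries S) (μ ∘ X) ∧
      ∀ G, entries S ⊆ G → φ₀ ∘ X ∈ G → φ₁ ∘ X ∈ G →
        ByQuadratures W G Y ∧ ByQuadratures W G (f ∘ X) ∧ ByQuadratures W G (g ∘ Y) := by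
  obtain ⟨h1, h2⟩ := h.byQuadratures_theta1
  obtain ⟨h3, h4⟩ := h.swap.byQuadratures_theta1
  rw [← theta2_eq_theta1_swap] at h3 h4
  have hKQ := h.byQuadratures_curvature hW hK
  have h2K := (ByQuadratures.const 2).sub hKQ
  have hL : ByQuadratures W (entries S) L :=
    .of_hasFDerivAt (fun q hq => (hN q hq).d_L.self_of_nhds)
      (.add _ _ (.mul _ _ h2K h1) h3) (.add _ _ (.mul _ _ h2K h2) h4)
  have hX : ByQuadratures W (entries S) X :=
    .of_hasFDerivAt (fun q hq => (hN q hq).d_X.self_of_nhds)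
      (.mul _ _ (.exp _ hL) h1) (.mul _ _ (.exp _ hL) h2)
  have hE := ByQuadratures.exp _ (.mul _ _ (.const (-2)) hL)
  refine ⟨hX, .congr _ _ (.mul _ _ ((ByQuadratures.const 1).sub hKQ) hE)
    fun q hq => (hN q hq).eq_μ.self_of_nhds.symm, fun G hG hG₀ hG₁ => ?_⟩
  have hX' := hX.mono hG
  have hXd : ∀ q ∈ W, DifferentiableAt ℝ X q := fun q hq =>
    (hN q hq).d_X.self_of_nhds.differentiableAt
  have hX0 : ∀ q ∈ W, fderiv ℝ X q ≠ 0 := fun q hq => by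
    obtain ⟨v, w, hv, -⟩ := h.exists_frame hq
    rw [(hN q hq).d_X.self_of_nhds.fderiv]
    exact smul_ne_zero (Real.exp_ne_zero _) fun h0 => by simp [h0] at hv
  have hφ₀ : ByQuadratures W G (φ₀ ∘ X) := .given _ hG₀
  have hφ₁ : ByQuadratures W G (φ₁ ∘ X) := .given _ hG₁
  have hψ₀ : ByQuadratures W G (ψ₀ ∘ X) := hX'.deriv_comp hφ₀ hXd hX0 fun q hq =>
    (hN q hq).d_φ₀.self_of_nhds.1
  have hψ₁ : ByQuadratures W G (ψ₁ ∘ X) := hX'.deriv_comp hφ₁ hXd hX0 fun q hq =>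
    (hN q hq).d_φ₁.self_of_nhds.1
  have hr := ByQuadratures.exp _ (hL.mono hG)
  have hP := hφ₀.sub (.mul _ _ hr hψ₀)
  have hPi := ByQuadratures.inv _ hP fun q hq => (hN q hq).denom_ne_zero.self_of_nhds
  have hP2i := ByQuadratures.inv _ (hP.pow 2) fun q hq =>
    pow_ne_zero 2 (hN q hq).denom_ne_zero.self_of_nhds
  have hY : ByQuadratures W G Y := .congr _ _ (.mul _ _ (hφ₁.sub (.mul _ _ hr hψ₁)) hPi)
    fun q hq => (hN q hq).eq_Y q
  have hV₂ := h.byQuadratures_invEigenvalueCoeff.mono hG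
  have hκ : ByQuadratures W G (κ ∘ Y) := .congr _ _ (.mul _ _ (.mul _ _ hV₂ (hP.pow 3))
    (hE.mono hG)) fun q hq => (hN q hq).eq_κ.self_of_nhds.symm
  have hb := (ByQuadratures.mul _ _ hr hP2i).neg
  have hYd : ∀ q ∈ W, _ := fun q hq => (hN q hq).d_Y.self_of_nhds
  have hg₁ : ByQuadratures W G (g₁ ∘ Y) :=
    .of_hasFDerivAt (fun q hq => (hN q hq).d_g.self_of_nhds.2.comp_hasFDerivAt q (hYd q hq))
      (.mul _ _ hκ (.mul _ _ hb (h3.mono hG))) (.mul _ _ hκ (.mul _ _ hb (h4.mono hG)))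
  have hg : ByQuadratures W G (g ∘ Y) :=
    .of_hasFDerivAt (fun q hq => (hN q hq).d_g.self_of_nhds.1.comp_hasFDerivAt q (hYd q hq))
      (.mul _ _ hg₁ (.mul _ _ hb (h3.mono hG))) (.mul _ _ hg₁ (.mul _ _ hb (h4.mono hG)))
  have hV := (ByQuadratures.inv _ h.swap.byQuadratures_eigenvalue h.B_ne_zero).mono hG
  exact ⟨hY, .congr _ _ (.add _ _ (.add _ _ hV (.mul _ _ hφ₀ hg)) (.mul _ _ (.mul _ _ hr hPi) hg₁))
    fun q hq => (hN q hq).eq_f.self_of_nhds.symm, hg⟩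

end IsInvertibleNondegenerateOn

end Computability

/-! ### Leaves in coordinate rectangles -/

section Leaves

variable {Φ : OpenPartialHomeomorph Plane Plane} {θ : OneForm} {ℓ : Plane →L[ℝ] ℝ}

theorem fderiv_apply_fderiv_symm (hΦ : ContDiffOn ℝ ∞ Φ Φ.source)
    (hΦ' : ContDiffOn ℝ ∞ Φ.symm Φ.target) {z : Plane} (hz : z ∈ Φ.target) (v : Plane) :
    fderiv ℝ Φ (Φ.symm z) (fderiv ℝ Φ.symm z v) = v := by
  have hz' := Φ.map_target hz
  have h1 : HasFDerivAt Φ.symm (fderiv ℝ Φ.symm z) z :=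
    (((hΦ' _ hz).contDiffAt (Φ.open_target.mem_nhds hz)).differentiableAt (by simp)).hasFDerivAt
  have h2 : HasFDerivAt Φ (fderiv ℝ Φ (Φ.symm z)) (Φ.symm z) :=
    (((hΦ _ hz').contDiffAt (Φ.open_source.mem_nhds hz')).differentiableAt (by simp)).hasFDerivAt
  have h3 : HasFDerivAt (fun z : Plane => z) _ z := (h2.comp z h1).congr_of_eventuallyEq (by
    filter_upwards [Φ.open_target.mem_nhds hz] with y hy using (Φ.right_inv hy).symm)
  exact (DFunLike.congr_fun ((hasFDerivAt_id z).unique h3) v).symm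

/-- The path is the preimage of the straight segment between the images, which stays in the convex
target and on a level of ℓ. -/
theorem exists_isLeafPath (hΦ : ContDiffOn ℝ ∞ Φ Φ.source)
    (hΦ' : ContDiffOn ℝ ∞ Φ.symm Φ.target) (hconv : Convex ℝ Φ.target)
    (hθ : ∀ q ∈ Φ.source, ∀ v, ℓ (fderiv ℝ Φ q v) = 0 → θ q v = 0) {a b : Plane}
    (ha : a ∈ Φ.source) (hb : b ∈ Φ.source) (hab : ℓ (Φ a) = ℓ (Φ b)) :
    ∃ γ γ' : ℝ → Plane, IsLeafPath Φ.source θ γ γ' ∧ γ 0 = a ∧ γ 1 = b := by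
  set z : ℝ → Plane := fun t => Φ a + t • (Φ b - Φ a) with hz
  have hmem : ∀ t ∈ Icc (0 : ℝ) 1, z t ∈ Φ.target := fun t ht =>
    hconv.add_smul_sub_mem (Φ.map_source ha) (Φ.map_source hb) ht
  have hzd : ∀ t, HasDerivAt z (Φ b - Φ a) t := fun t => by
    exact (((hasDerivAt_id t).smul_const (Φ b - Φ a)).const_add (Φ a)).congr_deriv (one_smul _ _)
  have hzc : Continuous z := continuous_iff_continuousAt.2 fun t => (hzd t).continuousAt
  refine ⟨fun t => Φ.symm (z t), fun t => fderiv ℝ Φ.symm (z t) (Φ b - Φ a), ⟨?_, ?_⟩, ?_, ?_⟩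
  · exact (((hΦ'.continuousOn_fderiv_of_isOpen Φ.open_target (by simp)).comp hzc.continuousOn
      hmem).clm_apply continuousOn_const)
  · intro t ht
    have h1 : HasFDerivAt Φ.symm (fderiv ℝ Φ.symm (z t)) (z t) :=
      (((hΦ' _ (hmem t ht)).contDiffAt (Φ.open_target.mem_nhds (hmem t ht))).differentiableAt
        (by simp)).hasFDerivAt
    refine ⟨(h1.comp_hasDerivAt t (hzd t)).hasDerivWithinAt, Φ.map_target (hmem t ht),
      hθ _ (Φ.map_target (hmem t ht)) _ ?_⟩
    rw [fderiv_apply_fderiv_symm hΦ hΦ' (hmem t ht), map_sub, hab, sub_self]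
  · simp [hz, Φ.left_inv ha]
  · simp [hz, Φ.left_inv hb]

theorem sameLeaf_iff (hΦ : ContDiffOn ℝ ∞ Φ Φ.source)
    (hΦ' : ContDiffOn ℝ ∞ Φ.symm Φ.target) (hconv : Convex ℝ Φ.target)
    (hθ : ∀ q ∈ Φ.source, ∀ v, ℓ (fderiv ℝ Φ q v) = 0 ↔ θ q v = 0) {a b : Plane} :
    SameLeaf Φ.source θ a b ↔ a ∈ Φ.source ∧ b ∈ Φ.source ∧ ℓ (Φ a) = ℓ (Φ b) := by
  constructor
  · rintro ⟨γ, γ', ⟨-, hγ⟩, rfl, rfl⟩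
    have h0 : (0 : ℝ) ∈ Icc (0 : ℝ) 1 := by simp
    have h1 : (1 : ℝ) ∈ Icc (0 : ℝ) 1 := by simp
    refine ⟨(hγ 0 h0).2.1, (hγ 1 h1).2.1, ?_⟩
    have hd : ∀ t ∈ Icc (0 : ℝ) 1,
        HasDerivWithinAt (fun t => ℓ (Φ (γ t))) 0 (Icc (0 : ℝ) 1) t := by
      intro t ht
      obtain ⟨ht1, ht2, ht3⟩ := hγ t ht
      have h2 : HasFDerivAt Φ (fderiv ℝ Φ (γ t)) (γ t) :=
        (((hΦ _ ht2).contDiffAt (Φ.open_source.mem_nhds ht2)).differentiableAt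
          (by simp)).hasFDerivAt
      have h3 := (ℓ.hasFDerivAt.comp (γ t) h2).comp_hasDerivWithinAt t ht1
      have h4 : (ℓ ∘SL fderiv ℝ Φ (γ t)) (γ' t) = 0 := (hθ _ ht2 _).2 ht3
      rw [h4] at h3
      exact h3
    refine (constant_of_has_deriv_right_zero (fun t ht => (hd t ht).continuousWithinAt)
      (fun t ht => ?_) 1 h1).symm
    exact (hd t (Ico_subset_Icc_self ht)).mono_of_mem_nhdsWithin (Icc_mem_nhdsGE_of_mem ht)
  · rintro ⟨ha, hb, hab⟩
    obtain ⟨γ, γ', h1, h2, h3⟩ :=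
      exists_isLeafPath hΦ hΦ' hconv (fun q hq v => (hθ q hq v).1) ha hb hab
    exact ⟨γ, γ', h1, h2, h3⟩

/-- Leaves are exactly the coordinate lines of the rectangle, so the common point is the one with
the first coordinate of `b` and the second of `a`. -/
theorem isThetaRectangular_of_coordinates {θ₁ θ₂ : OneForm} {I J : Set ℝ}
    (hΦ : ContDiffOn ℝ ∞ Φ Φ.source) (hΦ' : ContDiffOn ℝ ∞ Φ.symm Φ.target)
    (hT : Φ.target = I ×ˢ J) (hI : Convex ℝ I) (hJ : Convex ℝ J)
    (h₁ : ∀ q ∈ Φ.source, ∀ v, (fderiv ℝ Φ q v).1 = 0 ↔ θ₁ q v = 0)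
    (h₂ : ∀ q ∈ Φ.source, ∀ v, (fderiv ℝ Φ q v).2 = 0 ↔ θ₂ q v = 0) :
    IsThetaRectangular Φ.source θ₁ θ₂ := by
  have hconv : Convex ℝ Φ.target := hT ▸ hI.prod hJ
  intro a ha b hb
  have key : ∀ r, (SameLeaf Φ.source θ₂ a r ∧ SameLeaf Φ.source θ₁ b r) ↔
      r ∈ Φ.source ∧ Φ r = ((Φ b).1, (Φ a).2) := by
    intro r
    rw [sameLeaf_iff (ℓ := ContinuousLinearMap.snd ℝ ℝ ℝ) hΦ hΦ' hconv h₂,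
      sameLeaf_iff (ℓ := ContinuousLinearMap.fst ℝ ℝ ℝ) hΦ hΦ' hconv h₁]
    simp only [ha, hb, true_and, ContinuousLinearMap.coe_fst', ContinuousLinearMap.coe_snd',
      Prod.ext_iff]
    constructor
    · rintro ⟨⟨hr, h1⟩, -, h2⟩
      exact ⟨hr, h2.symm, h1.symm⟩
    · rintro ⟨hr, h1, h2⟩
      exact ⟨⟨hr, h2.symm⟩, hr, h1.symm⟩
  have hm : ((Φ b).1, (Φ a).2) ∈ Φ.target := by
    have ha' := Φ.map_source ha
    have hb' := Φ.map_source hb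
    rw [hT] at ha' hb' ⊢
    exact ⟨hb'.1, ha'.2⟩
  refine ⟨Φ.symm ((Φ b).1, (Φ a).2), (key _).2 ⟨Φ.map_target hm, Φ.right_inv hm⟩, fun r hr => ?_⟩
  obtain ⟨hr1, hr2⟩ := (key r).1 hr
  rw [← hr2, Φ.left_inv hr1]

theorem IsLeafPath.integral_eq {W : Set Plane} {θ σ : OneForm} {γ γ' : ℝ → Plane} {w : Plane → ℝ}
    (hγ : IsLeafPath W θ γ γ') (hσ : ContinuousOn σ W) (hw : ∀ q ∈ W, DifferentiableAt ℝ w q)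
    (hd : ∀ q ∈ W, ∀ v, θ q v = 0 → fderiv ℝ w q v = σ q v) :
    ∫ t in (0 : ℝ)..1, σ (γ t) (γ' t) = w (γ 1) - w (γ 0) := by
  have hγc : ContinuousOn γ (Icc 0 1) := fun t ht => (hγ.2 t ht).1.continuousWithinAt
  have hdw : ∀ t ∈ Icc (0 : ℝ) 1,
      HasDerivWithinAt (fun t => w (γ t)) (σ (γ t) (γ' t)) (Icc 0 1) t := by
    intro t ht
    obtain ⟨h1, h2, h3⟩ := hγ.2 t ht
    rw [← hd _ h2 _ h3]
    exact (hw _ h2).hasFDerivAt.comp_hasDerivWithinAt t h1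
  refine intervalIntegral.integral_eq_sub_of_hasDerivAt_of_le zero_le_one
    (fun t ht => (hdw t ht).continuousWithinAt)
    (fun t ht => (hdw t (Ioo_subset_Icc_self ht)).hasDerivAt (Icc_mem_nhds ht.1 ht.2)) ?_
  refine ContinuousOn.intervalIntegrable ?_
  rw [uIcc_of_le zero_le_one]
  exact (hσ.comp hγc fun t ht => (hγ.2 t ht).2.1).clm_apply hγ.1

end Leaves

/-! ### The normal form in the plane -/

theorem IsInvertibleNondegenerateOn.mono {W W' : Set Plane} {S : OperatorField} {A B : Plane → ℝ}
    (h : IsInvertibleNondegenerateOn W S A B) (hW : W' ⊆ W) :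
    IsInvertibleNondegenerateOn W' S A B where
  smooth_S := h.smooth_S.mono hW
  smooth_A := h.smooth_A.mono hW
  smooth_B := h.smooth_B.mono hW
  eigen_A q hq := h.eigen_A q (hW hq)
  eigen_B q hq := h.eigen_B q (hW hq)
  A_ne_B q hq := h.A_ne_B q (hW hq)
  A_ne_zero q hq := h.A_ne_zero q (hW hq)
  B_ne_zero q hq := h.B_ne_zero q (hW hq)
  dDoublePrime_A_ne_zero q hq := h.dDoublePrime_A_ne_zero q (hW hq)
  dPrime_B_ne_zero q hq := h.dPrime_B_ne_zero q (hW hq)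

theorem eq_zero_of_wedge_ne_zero {σ τ : OneForm} {q v : Plane}
    (h : wedge σ τ q (1, 0) (0, 1) ≠ 0) (h₁ : σ q v = 0) (h₂ : τ q v = 0) : v = 0 := by
  rw [clm_apply_plane] at h₁ h₂
  simp only [smul_eq_mul, wedge] at h₁ h₂ h
  ext
  · apply mul_left_cancel₀ h
    simp only [Prod.fst_zero, mul_zero]
    linear_combination τ q (0, 1) * h₁ - σ q (0, 1) * h₂
  · apply mul_left_cancel₀ h
    simp only [Prod.snd_zero, mul_zero]
    linear_combination σ q (1, 0) * h₂ - τ q (1, 0) * h₁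

/-! ### Persistence and coordinate properties of the normal form germ -/

section

variable {p : Plane} {θ₁ θ₂ : OneForm} {K U V V₂ L X Y : Plane → ℝ}
  {f φ₀ φ₁ ψ₀ ψ₁ g g₁ κ μ : ℝ → ℝ}

/-- All conditions are open, so one set of data serves every point of a neighbourhood; the rectangle
is cut out of it. -/
theorem IsNormalFormGerm.eventually
    (h : IsNormalFormGerm p θ₁ θ₂ K U V V₂ L X Y f φ₀ φ₁ ψ₀ ψ₁ g g₁ κ μ) :
    ∀ᶠ q in 𝓝 p, IsNormalFormGerm q θ₁ θ₂ K U V V₂ L X Y f φ₀ φ₁ ψ₀ ψ₁ g g₁ κ μ := by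
  have hX := h.smooth_X.continuousAt
  have hY := h.smooth_Y.continuousAt
  filter_upwards [eventually_eventually_nhds.2 h.smooth_L, eventually_eventually_nhds.2 h.smooth_X,
    eventually_eventually_nhds.2 h.smooth_Y, hX.eventually (eventually_eventually_nhds.2 h.smooth_f),
    hX.eventually (eventually_eventually_nhds.2 h.smooth_φ₀),
    hX.eventually (eventually_eventually_nhds.2 h.smooth_φ₁),
    hX.eventually (eventually_eventually_nhds.2 h.smooth_μ),
    hY.eventually (eventually_eventually_nhds.2 h.smooth_g),
    eventually_eventually_nhds.2 h.d_L, eventually_eventually_nhds.2 h.d_X,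
    eventually_eventually_nhds.2 h.d_Y, eventually_eventually_nhds.2 h.denom_ne_zero,
    eventually_eventually_nhds.2 h.eq_μ,
    hX.eventually (eventually_eventually_nhds.2 h.d_φ₀),
    hX.eventually (eventually_eventually_nhds.2 h.d_φ₁),
    hX.eventually (eventually_eventually_nhds.2 h.wronskian),
    hY.eventually (eventually_eventually_nhds.2 h.d_g),
    eventually_eventually_nhds.2 h.eq_κ, eventually_eventually_nhds.2 h.eq_f,
    eventually_eventually_nhds.2 h.eq_U, eventually_eventually_nhds.2 h.eq_V]
    with q a1 a2 a3 a4 a5 a6 a7 a8 a9 a10 a11 a12 a13 a14 a15 a16 a17 a18 a19 a20 a21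
  exact ⟨a1, a2, a3, a4, a5, a6, a7, a8, a9, a10, a11, h.eq_Y, a12, a13, a14, a15, a16, a17, a18,
    a19, a20, a21⟩

namespace IsNormalFormGerm

theorem fderiv_X_eq_zero_iff
    (h : IsNormalFormGerm p θ₁ θ₂ K U V V₂ L X Y f φ₀ φ₁ ψ₀ ψ₁ g g₁ κ μ) (v : Plane) :
    fderiv ℝ X p v = 0 ↔ θ₁ p v = 0 := by
  rw [h.d_X.self_of_nhds.fderiv]
  simp [Real.exp_ne_zero]

theorem fderiv_Y_eq_zero_iff
    (h : IsNormalFormGerm p θ₁ θ₂ K U V V₂ L X Y f φ₀ φ₁ ψ₀ ψ₁ g g₁ κ μ) (v : Plane) :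
    fderiv ℝ Y p v = 0 ↔ θ₂ p v = 0 := by
  rw [h.d_Y.self_of_nhds.fderiv]
  simp [Real.exp_ne_zero, h.denom_ne_zero.self_of_nhds]

theorem fderiv_prodMk
    (h : IsNormalFormGerm p θ₁ θ₂ K U V V₂ L X Y f φ₀ φ₁ ψ₀ ψ₁ g g₁ κ μ) (v : Plane) :
    fderiv ℝ (fun q => (X q, Y q)) p v = (fderiv ℝ X p v, fderiv ℝ Y p v) := by
  have h1 := h.d_X.self_of_nhds.differentiableAt
  have h2 := h.d_Y.self_of_nhds.differentiableAt
  rw [(h1.hasFDerivAt.prodMk h2.hasFDerivAt).fderiv]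
  rfl

theorem deriv_deriv
    (h : IsNormalFormGerm p θ₁ θ₂ K U V V₂ L X Y f φ₀ φ₁ ψ₀ ψ₁ g g₁ κ μ) :
    deriv (deriv φ₀) (X p) + μ (X p) * φ₀ (X p) = 0 ∧
      deriv (deriv φ₁) (X p) + μ (X p) * φ₁ (X p) = 0 := by
  have key : ∀ {φ ψ : ℝ → ℝ}, (∀ᶠ s in 𝓝 (X p), HasDerivAt φ (ψ s) s ∧
      HasDerivAt ψ (-(μ s * φ s)) s) → deriv (deriv φ) (X p) + μ (X p) * φ (X p) = 0 := by
    intro φ ψ hd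
    have h1 : deriv φ =ᶠ[𝓝 (X p)] ψ := hd.mono fun s hs => hs.1.deriv
    rw [h1.deriv_eq, hd.self_of_nhds.2.deriv]
    ring
  exact ⟨key h.d_φ₀, key h.d_φ₁⟩

theorem deriv_wronskian
    (h : IsNormalFormGerm p θ₁ θ₂ K U V V₂ L X Y f φ₀ φ₁ ψ₀ ψ₁ g g₁ κ μ) :
    φ₀ (X p) * deriv φ₁ (X p) - φ₁ (X p) * deriv φ₀ (X p) = 1 := by
  rw [h.d_φ₀.self_of_nhds.1.deriv, h.d_φ₁.self_of_nhds.1.deriv]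
  exact h.wronskian.self_of_nhds

theorem deriv_sub_ne_zero
    (h : IsNormalFormGerm p θ₁ θ₂ K U V V₂ L X Y f φ₀ φ₁ ψ₀ ψ₁ g g₁ κ μ) :
    deriv φ₁ (X p) - Y p * deriv φ₀ (X p) ≠ 0 := by
  have hP := h.denom_ne_zero.self_of_nhds
  have hw := h.wronskian.self_of_nhds
  rw [h.d_φ₀.self_of_nhds.1.deriv, h.d_φ₁.self_of_nhds.1.deriv, h.eq_Y]
  intro h0
  have h1 := mul_inv_cancel₀ hP
  apply one_ne_zero (α := ℝ)
  linear_combination (φ₀ (X p) - Real.exp (L p) * ψ₀ (X p)) * h0 - hw +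
    (φ₁ (X p) - Real.exp (L p) * ψ₁ (X p)) * ψ₀ (X p) * h1

end IsNormalFormGerm

end

/-- Near each point of the plane, an operator of Type I has the explicit normal form, with
computable data. -/
theorem IsTypeIOn.exists_normalForm {W : Set Plane} {S : OperatorField} {A B : Plane → ℝ}
    (hT : IsTypeIOn W S A B) (hW : IsOpen W) {p : Plane} (hp : p ∈ W) :
    ∃ (Φ : OpenPartialHomeomorph Plane Plane) (x₁ x₂ y₁ y₂ : ℝ) (f φ₀ φ₁ g : ℝ → ℝ),
      p ∈ Φ.source ∧ Φ.source ⊆ W ∧ ContDiffOn ℝ ∞ Φ Φ.source ∧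
      ContDiffOn ℝ ∞ Φ.symm Φ.target ∧ Φ.target = Ioo x₁ x₂ ×ˢ Ioo y₁ y₂ ∧
      IsThetaRectangular Φ.source (theta1 S A B) (theta2 S A B) ∧
      IsNormalFormData (Ioo x₁ x₂) (Ioo y₁ y₂) f φ₀ φ₁ g ∧
      (∀ q ∈ Φ.source, A q = explicitA f φ₀ φ₁ g (Φ q) ∧ B q = explicitB f φ₀ φ₁ g (Φ q) ∧
        ∀ v, fderiv ℝ Φ q (S q v) = diagOperator (A q) (B q) (fderiv ℝ Φ q v)) ∧
      IsComputableFrom Φ.source S A B (Ioo x₁ x₂) (fun q => (Φ q).1) (fun q => (Φ q).2)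
        f φ₀ φ₁ g := by
  obtain ⟨K, hK, hG⟩ := hT.isTypeIGerm hW
  obtain ⟨L, X, Y, f, φ₀, φ₁, ψ₀, ψ₁, g, g₁, κ, μ, hN⟩ := (hG p hp).exists_normalForm
  have hθ₁ := (hG p hp).smooth_θ₁
  have hS := hT.1
  -- the transversal `c = 0`
  set c : Plane → ℝ := fun q => theta2 S A B p (q - p) with hc
  have hcd : ∀ q, HasFDerivAt c (theta2 S A B p) q := fun q =>
    (theta2 S A B p).hasFDerivAt.comp q ((hasFDerivAt_id q).sub_const p)
  have hcs : SmoothNear c p := smoothNear_of_contDiff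
    ((theta2 S A B p).contDiff.comp (contDiff_id.sub contDiff_const))
  have hcp : c p = 0 := by simp [hc]
  -- `c` is affine with constant differential θ₂(p), which stays independent of θ₁ near `p`; hence
  -- its zero line is transverse to the curves θ₁ = 0.
  have htrans : ∀ᶠ q in 𝓝 p, wedge (theta1 S A B) (fun _ => theta2 S A B p) q (1, 0) (0, 1) ≠ 0 :=
    (((hθ₁.clm_apply (smoothNear_const _)).mul (smoothNear_const _)).sub
      ((hθ₁.clm_apply (smoothNear_const _)).mul (smoothNear_const _))).continuousAt.eventually_ne
      (hS.wedge_ne_zero hp)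
  have hgood : ∀ᶠ q in 𝓝 p, (q ∈ W ∧
      wedge (theta1 S A B) (fun _ => theta2 S A B p) q (1, 0) (0, 1) ≠ 0) ∧
      IsNormalFormGerm q (theta1 S A B) (theta2 S A B) K (fun q => (A q)⁻¹) (fun q => (B q)⁻¹)
        (invEigenvalueCoeff S A B) L X Y f φ₀ φ₁ ψ₀ ψ₁ g g₁ κ μ :=
    ((hW.eventually_mem hp).and htrans).and hN.eventually
  -- the coordinates, and the coordinates adapted to the transversal
  obtain ⟨Φ₀, hpΦ₀, hsub₀, hΦ₀F, hΦ₀, hΦ₀'⟩ := exists_local_diffeomorph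
    (hN.smooth_X.prodMk hN.smooth_Y) (fun v hv => by
      rw [hN.fderiv_prodMk] at hv
      exact eq_zero_of_wedge_ne_zero (hS.wedge_ne_zero hp)
        ((hN.fderiv_X_eq_zero_iff v).1 (congrArg Prod.fst hv))
        ((hN.fderiv_Y_eq_zero_iff v).1 (congrArg Prod.snd hv))) hgood
  -- The coordinates (X, c) locate the point of {c = 0} on the curve X = s: it is `foot s` below.
  obtain ⟨Ψ, hpΨ, hsubΨ, hΨF, -, hΨ'⟩ := exists_local_diffeomorph
    (hN.smooth_X.prodMk hcs) (fun v hv => by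
      rw [(hN.d_X.self_of_nhds.prodMk (hcd p)).fderiv] at hv
      have h1 : Real.exp (L p) * theta1 S A B p v = 0 := congrArg Prod.fst hv
      exact eq_zero_of_wedge_ne_zero (hS.wedge_ne_zero hp)
        ((mul_eq_zero.1 h1).resolve_left (Real.exp_ne_zero _)) (congrArg Prod.snd hv))
    (Φ₀.open_source.mem_nhds hpΦ₀)
  have hΨp : Ψ p = (X p, 0) := by rw [hΨF, ← hcp]
  set foot : ℝ → Plane := fun s => Ψ.symm (s, 0) with hfoot
  have hfp : foot (X p) = p := by rw [hfoot]; simp only; rw [← hΨp, Ψ.left_inv hpΨ]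
  have hfoots : ∀ s, (s, (0 : ℝ)) ∈ Ψ.target → ContDiffAt ℝ ∞ foot s := fun s hs =>
    ContDiffAt.comp s ((hΨ' _ hs).contDiffAt (Ψ.open_target.mem_nhds hs))
      (contDiffAt_id.prodMk contDiffAt_const)
  have hfootm : ∀ s, (s, (0 : ℝ)) ∈ Ψ.target →
      foot s ∈ Ψ.source ∧ X (foot s) = s ∧ c (foot s) = 0 := fun s hs => by
    have h1 := Ψ.right_inv hs
    rw [hΨF] at h1
    exact ⟨Ψ.map_target hs, congrArg Prod.fst h1, congrArg Prod.snd h1⟩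
  have hXpt : (X p, (0 : ℝ)) ∈ Ψ.target := hΨp ▸ Ψ.map_source hpΨ
  -- the rectangle
  have hΦ₀p : Φ₀ p = (X p, Y p) := by rw [hΦ₀F]
  obtain ⟨ε, hε, hball⟩ := Metric.isOpen_iff.1 Φ₀.open_target _ (hΦ₀p ▸ Φ₀.map_source hpΦ₀)
  rw [← ball_prod_same, Real.ball_eq_Ioo, Real.ball_eq_Ioo] at hball
  have hY₀ : Y p ∈ Ioo (Y p - ε) (Y p + ε) := ⟨by linarith, by linarith⟩
  -- The interval for Y is fixed; the one for X is shrunk until the foot of every curve X = s has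
  -- its Y-value in it. So each second-family curve of the rectangle meets {c = 0} inside the
  -- rectangle.
  have hnear : ∀ᶠ s in 𝓝 (X p), ((s, (0 : ℝ)) ∈ Ψ.target ∧
      Y (foot s) ∈ Ioo (Y p - ε) (Y p + ε)) ∧ s ∈ Ioo (X p - ε) (X p + ε) := by
    have h1 : ContinuousAt (fun s : ℝ => (s, (0 : ℝ))) (X p) := by fun_prop
    have h2 : ContinuousAt (fun s => Y (foot s)) (X p) :=
      ContinuousAt.comp (by rw [hfp]; exact hN.smooth_Y.continuousAt)
        (hfoots _ hXpt).continuousAt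
    exact ((h1.eventually_mem (Ψ.open_target.mem_nhds hXpt)).and
      (h2.eventually_mem (isOpen_Ioo.mem_nhds (by rw [hfp]; exact hY₀)))).and
      (Ioo_mem_nhds (by linarith) (by linarith))
  obtain ⟨δ, hδ, hI⟩ := Metric.eventually_nhds_iff_ball.1 hnear
  rw [Real.ball_eq_Ioo] at hI
  have hX₀ : X p ∈ Ioo (X p - δ) (X p + δ) := ⟨by linarith, by linarith⟩
  set I := Ioo (X p - δ) (X p + δ) with hIdef
  set J := Ioo (Y p - ε) (Y p + ε) with hJdef
  have hIJ : I ×ˢ J ⊆ Φ₀.target := fun z hz => hball ⟨(hI _ hz.1).2, hz.2⟩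
  have hIJo : IsOpen (I ×ˢ J) := isOpen_Ioo.prod isOpen_Ioo
  obtain ⟨Φ, hΦs, hΦt, hΦF, hΦsymm⟩ : ∃ Φ : OpenPartialHomeomorph Plane Plane,
      Φ.source = Φ₀.source ∩ Φ₀ ⁻¹' (I ×ˢ J) ∧ Φ.target = I ×ˢ J ∧
      (Φ : Plane → Plane) = (fun q => (X q, Y q)) ∧ (Φ.symm : Plane → Plane) = Φ₀.symm := by
    refine ⟨(Φ₀.symm.restrOpen (I ×ˢ J) hIJo).symm, ?_, ?_, hΦ₀F, rfl⟩
    · simp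
    · simp [inter_eq_right.2 hIJ]
  have hΦsub : Φ.source ⊆ Φ₀.source := hΦs ▸ inter_subset_left
  have hmem : ∀ q ∈ Φ₀.source, X q ∈ I → Y q ∈ J → q ∈ Φ.source := fun q hq h1 h2 => by
    rw [hΦs]
    refine ⟨hq, ?_⟩
    rw [mem_preimage, hΦ₀F]
    exact ⟨h1, h2⟩
  have hΦX : ∀ q ∈ Φ.source, X q ∈ I := fun q hq => by
    have := Φ.map_source hq
    rw [hΦt, hΦF] at this
    exact this.1
  have hpΦ : p ∈ Φ.source := hmem p hpΦ₀ hX₀ hY₀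
  have hΦsm : ContDiffOn ℝ ∞ Φ Φ.source := by
    rw [hΦF, ← hΦ₀F]; exact hΦ₀.mono hΦsub
  have hΦsm' : ContDiffOn ℝ ∞ Φ.symm Φ.target := by
    rw [hΦsymm]; exact hΦ₀'.mono (hΦt ▸ hIJ)
  have hsurj : ∀ x ∈ I, ∀ y ∈ J, ∃ q ∈ Φ.source, X q = x ∧ Y q = y := fun x hx y hy => by
    have hm : (x, y) ∈ Φ.target := hΦt ▸ ⟨hx, hy⟩
    have h1 := Φ.right_inv hm
    rw [hΦF] at h1
    exact ⟨_, Φ.map_target hm, congrArg Prod.fst h1, congrArg Prod.snd h1⟩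
  have hNq : ∀ q ∈ Φ.source, _ := fun q hq => (hsub₀ (hΦsub hq)).2
  have hΦW : Φ.source ⊆ W := fun q hq => (hsub₀ (hΦsub hq)).1.1
  have hSΦ := hS.mono hΦW
  have hdΦ : ∀ q ∈ Φ.source, ∀ v, fderiv ℝ Φ q v = (fderiv ℝ X q v, fderiv ℝ Y q v) :=
    fun q hq v => by rw [hΦF]; exact (hNq q hq).fderiv_prodMk v
  have hθ₁Φ : ∀ q ∈ Φ.source, ∀ v, (fderiv ℝ Φ q v).1 = 0 ↔ theta1 S A B q v = 0 :=
    fun q hq v => by rw [hdΦ q hq]; exact (hNq q hq).fderiv_X_eq_zero_iff v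
  have hθ₂Φ : ∀ q ∈ Φ.source, ∀ v, (fderiv ℝ Φ q v).2 = 0 ↔ theta2 S A B q v = 0 :=
    fun q hq v => by rw [hdΦ q hq]; exact (hNq q hq).fderiv_Y_eq_zero_iff v
  have hsmI : ∀ {k : ℝ → ℝ}, (∀ q ∈ Φ.source, SmoothNear k (X q)) → ContDiffOn ℝ ∞ k I :=
    fun hk x hx => by
      obtain ⟨q, hq, rfl, -⟩ := hsurj x hx _ hY₀
      exact (hk q hq).self.contDiffWithinAt
  -- the parametrized quadrature
  set w : Plane → ℝ := fun q => L q - L (foot (X q)) with hw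
  have hρ : ∀ s ∈ I, ContDiffAt ℝ ∞ (fun s => L (foot s)) s := fun s hs =>
    ContDiffAt.comp s (hsub₀ (hsubΨ (hfootm s (hI s hs).1.1).1)).2.smooth_L.self
      (hfoots s (hI s hs).1.1)
  have hws : ∀ q ∈ Φ.source, ContDiffAt ℝ ∞ w q := fun q hq =>
    (hNq q hq).smooth_L.self.sub (ContDiffAt.comp (g := fun s => L (foot s)) q (hρ _ (hΦX q hq))
      (hNq q hq).smooth_X.self)
  -- The subtracted term depends on X only, so along θ₁ = 0 the differential of w is that of L,
  -- namely θ₂.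
  have hwd : ∀ q ∈ Φ.source, ∀ v, theta1 S A B q v = 0 → fderiv ℝ w q v = theta2 S A B q v := by
    intro q hq v hv
    have hd := (hNq q hq).d_L.self_of_nhds.fun_sub
      (((hρ _ (hΦX q hq)).differentiableAt (by simp)).hasDerivAt.comp_hasFDerivAt q
        (hNq q hq).d_X.self_of_nhds)
    have hd' : fderiv ℝ w q = _ := hd.fderiv
    rw [hd']
    simp [hv]
  obtain ⟨hQX, hQμ, hQ⟩ := hSΦ.byQuadratures_normalForm Φ.open_source
    (fun q hq => hK q (hΦW hq)) hNq
  obtain ⟨hQY, hQf, hQg⟩ := hQ (entries S ∪ {w, φ₀ ∘ X, φ₁ ∘ X}) subset_union_left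
    (by simp) (by simp)
  have hΦ1 : (fun q => (Φ q).1) = X := by rw [hΦF]
  have hΦ2 : (fun q => (Φ q).2) = Y := by rw [hΦF]
  refine ⟨Φ, X p - δ, X p + δ, Y p - ε, Y p + ε, f, φ₀, φ₁, g, hpΦ, hΦW, hΦsm, hΦsm', hΦt,
    isThetaRectangular_of_coordinates hΦsm hΦsm' hΦt (convex_Ioo _ _) (convex_Ioo _ _) hθ₁Φ hθ₂Φ,
    ⟨hsmI fun q hq => (hNq q hq).smooth_f, hsmI fun q hq => (hNq q hq).smooth_φ₀,
      hsmI fun q hq => (hNq q hq).smooth_φ₁, ?_, ?_, ?_⟩, ?_, ?_⟩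
  · intro y hy
    obtain ⟨q, hq, -, rfl⟩ := hsurj _ hX₀ y hy
    exact (hNq q hq).smooth_g.self.contDiffWithinAt
  · intro x hx
    obtain ⟨q, hq, rfl, -⟩ := hsurj x hx _ hY₀
    exact (hNq q hq).deriv_wronskian
  · intro x hx y hy
    obtain ⟨q, hq, rfl, rfl⟩ := hsurj x hx y hy
    exact (hNq q hq).deriv_sub_ne_zero
  · intro q hq
    refine ⟨?_, ?_, fun v => ?_⟩
    · rw [explicitA, hΦF, ← (hNq q hq).eq_U.self_of_nhds, one_div, inv_inv]
    · rw [explicitB, hΦF, ← (hNq q hq).eq_V.self_of_nhds, one_div, inv_inv]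
    · rw [hdΦ q hq, hdΦ q hq, (hNq q hq).d_X.self_of_nhds.fderiv,
        (hNq q hq).d_Y.self_of_nhds.fderiv]
      ext <;> simp [diagOperator, hSΦ.theta1_apply_eq hq, hSΦ.theta2_apply_eq hq] <;> ring
  · rw [hΦ1, hΦ2]
    refine ⟨c, w, μ, byQuadratures_affine _ _, fun q hq => (hws q hq).contDiffWithinAt,
      ⟨fun q hq => ?_, fun q hq => ?_⟩, hQX.mono subset_union_left, hQμ.mono subset_union_left,
      hsmI fun q hq => (hNq q hq).smooth_μ, fun x hx => ?_, fun x hx => ?_, hQY, hQf, hQg⟩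
    -- A spanning vector of the kernel of θ₁; dc takes on it the value of θ₁ ∧ θ₂(p) on the
    -- coordinate basis.
    · refine ⟨(-theta1 S A B q (0, 1), theta1 S A B q (1, 0)), ?_, ?_⟩
      · rw [clm_apply_plane]
        simp only [smul_eq_mul]
        ring
      · rw [(hcd q).fderiv, clm_apply_plane]
        intro h0
        apply (hsub₀ (hΦsub hq)).1.2
        simp only [smul_eq_mul] at h0
        simp only [wedge]
        linear_combination h0
    · have hIq := hΦX q hq
      obtain ⟨hf1, hf2, hf3⟩ := hfootm _ (hI _ hIq).1.1
      have hfm : foot (X q) ∈ Φ.source :=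
        hmem _ (hsubΨ hf1) (by rw [hf2]; exact hIq) (hI _ hIq).1.2
      obtain ⟨γ, γ', hγ, hγ0, hγ1⟩ := exists_isLeafPath (ℓ := ContinuousLinearMap.fst ℝ ℝ ℝ) hΦsm
        hΦsm' (hΦt ▸ (convex_Ioo _ _).prod (convex_Ioo _ _)) (fun q hq v => (hθ₁Φ q hq v).1)
        hfm hq (by rw [hΦF]; exact hf2)
      refine ⟨γ, γ', hγ, by rw [hγ0, hf3], hγ1, ?_⟩
      -- The integral is w(q) - w(foot), and w vanishes at the foot, which is its own foot.
      rw [hγ.integral_eq (σ := theta2 S A B) ((hSΦ.swap.smooth_theta1 Φ.open_source).continuousOn)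
        (fun q hq => (hws q hq).differentiableAt (by simp)) hwd, hγ0, hγ1]
      simp [hw, hf2]
    · obtain ⟨q, hq, rfl, -⟩ := hsurj x hx _ hY₀
      exact (hNq q hq).deriv_deriv.1
    · obtain ⟨q, hq, rfl, -⟩ := hsurj x hx _ hY₀
      exact (hNq q hq).deriv_deriv.2

/-! ### The normal form on a surface -/

theorem IsComputableFrom.congr {W : Set Plane} {S : OperatorField} {A B : Plane → ℝ} {I : Set ℝ}
    {X X' Y Y' : Plane → ℝ} {f φ₀ φ₁ g : ℝ → ℝ}
    (h : IsComputableFrom W S A B I X Y f φ₀ φ₁ g) (hX : EqOn X' X W) (hY : EqOn Y' Y W) :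
    IsComputableFrom W S A B I X' Y' f φ₀ φ₁ g := by
  obtain ⟨c, w, μ, h1, h2, h3, h4, h5, h6, h7, h8, h9, h10, h11⟩ := h
  have hX' : ∀ k : ℝ → ℝ, EqOn (k ∘ X') (k ∘ X) W := fun k q hq => congrArg k (hX hq)
  have hY' : ∀ k : ℝ → ℝ, EqOn (k ∘ Y') (k ∘ Y) W := fun k q hq => congrArg k (hY hq)
  have hG : ∀ k ∈ entries S ∪ {w, φ₀ ∘ X, φ₁ ∘ X},
      ByQuadratures W (entries S ∪ {w, φ₀ ∘ X', φ₁ ∘ X'}) k := by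
    rintro k (hk | rfl | rfl | rfl)
    · exact .given _ (Or.inl hk)
    · exact .given _ (by simp)
    · exact .congr (φ₀ ∘ X') _ (.given _ (by simp)) (hX' φ₀).symm
    · exact .congr (φ₁ ∘ X') _ (.given _ (by simp)) (hX' φ₁).symm
  exact ⟨c, w, μ, h1, h2, h3, .congr _ _ h4 hX, .congr _ _ h5 (hX' μ), h6, h7, h8,
    .congr _ _ (h9.trans hG) hY, .congr _ _ (h10.trans hG) (hX' f),
    .congr _ _ (h11.trans hG) (hY' g)⟩

section Surface

variable {M : Type*} [TopologicalSpace M] [ChartedSpace Plane M]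

theorem trans_mem_maximalAtlas [IsManifold 𝓘(ℝ, Plane) ∞ M]
    {e₀ : OpenPartialHomeomorph M Plane}
    (he₀ : e₀ ∈ IsManifold.maximalAtlas 𝓘(ℝ, Plane) ∞ M) {Φ : OpenPartialHomeomorph Plane Plane}
    (hΦ : ContDiffOn ℝ ∞ Φ Φ.source) (hΦ' : ContDiffOn ℝ ∞ Φ.symm Φ.target) :
    e₀.trans Φ ∈ IsManifold.maximalAtlas 𝓘(ℝ, Plane) ∞ M := by
  refine (e₀.trans Φ).mem_maximalAtlas_of_contMDiffOn ?_ ?_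
  · exact hΦ.contMDiffOn.comp
      ((contMDiffOn_of_mem_maximalAtlas he₀).mono (by simp)) (by simp)
  · refine (contMDiffOn_symm_of_mem_maximalAtlas he₀).comp
      (hΦ'.contMDiffOn.mono (by simp)) ?_
    intro q hq
    rw [OpenPartialHomeomorph.trans_target] at hq
    exact hq.2

/-- The chain rule for the two manifold derivatives: changing the chart by `Φ` conjugates the
coordinate expression by dΦ. -/
theorem localRep_trans (S : ∀ p : M, TangentSpace 𝓘(ℝ, Plane) p →L[ℝ] TangentSpace 𝓘(ℝ, Plane) p)
    {e₀ : OpenPartialHomeomorph M Plane}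
    (he₀ : e₀ ∈ IsManifold.maximalAtlas 𝓘(ℝ, Plane) ∞ M) {Φ : OpenPartialHomeomorph Plane Plane}
    (hΦ : ContDiffOn ℝ ∞ Φ Φ.source) (hΦ' : ContDiffOn ℝ ∞ Φ.symm Φ.target)
    (hsub : Φ.source ⊆ e₀.target) {q : Plane} (hq : q ∈ Φ.target) (v : Plane) :
    localRep S (e₀.trans Φ) q v =
      fderiv ℝ Φ (Φ.symm q) (localRep S e₀ (Φ.symm q) (fderiv ℝ Φ.symm q v)) := by
  have hz := Φ.map_target hq
  have hz₀ := hsub hz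
  have hx := e₀.map_target hz₀
  have h1 : MDifferentiableAt 𝓘(ℝ, Plane) 𝓘(ℝ, Plane) e₀ (e₀.symm (Φ.symm q)) :=
    (contMDiffAt_of_mem_maximalAtlas he₀ hx).mdifferentiableAt (by simp)
  have h2 : MDifferentiableAt 𝓘(ℝ, Plane) 𝓘(ℝ, Plane) e₀.symm (Φ.symm q) :=
    (contMDiffAt_symm_of_mem_maximalAtlas he₀ hz₀).mdifferentiableAt (by simp)
  have h3 : MDifferentiableAt 𝓘(ℝ, Plane) 𝓘(ℝ, Plane) Φ (e₀ (e₀.symm (Φ.symm q))) := by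
    rw [e₀.right_inv hz₀]
    exact (((hΦ _ hz).contDiffAt (Φ.open_source.mem_nhds hz)).differentiableAt
      (by simp)).mdifferentiableAt
  have h4 : MDifferentiableAt 𝓘(ℝ, Plane) 𝓘(ℝ, Plane) Φ.symm q :=
    (((hΦ' _ hq).contDiffAt (Φ.open_target.mem_nhds hq)).differentiableAt
      (by simp)).mdifferentiableAt
  have h5 : mfderiv 𝓘(ℝ, Plane) 𝓘(ℝ, Plane) (e₀.trans Φ) (e₀.symm (Φ.symm q)) =
      (mfderiv 𝓘(ℝ, Plane) 𝓘(ℝ, Plane) Φ (e₀ (e₀.symm (Φ.symm q)))).comp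
        (mfderiv 𝓘(ℝ, Plane) 𝓘(ℝ, Plane) e₀ (e₀.symm (Φ.symm q))) := mfderiv_comp _ h3 h1
  have h6 : mfderiv 𝓘(ℝ, Plane) 𝓘(ℝ, Plane) (e₀.trans Φ).symm q =
      (mfderiv 𝓘(ℝ, Plane) 𝓘(ℝ, Plane) e₀.symm (Φ.symm q)).comp
        (mfderiv 𝓘(ℝ, Plane) 𝓘(ℝ, Plane) Φ.symm q) := mfderiv_comp _ h2 h4
  rw [mfderiv_eq_fderiv] at h5 h6
  rw [e₀.right_inv hz₀] at h5
  have h7 : localRep S (e₀.trans Φ) q =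
    (mfderiv 𝓘(ℝ, Plane) 𝓘(ℝ, Plane) (e₀.trans Φ) (e₀.symm (Φ.symm q))).comp
    ((S (e₀.symm (Φ.symm q))).comp (mfderiv 𝓘(ℝ, Plane) 𝓘(ℝ, Plane) (e₀.trans Φ).symm q)) := rfl
  rw [h7, h6, h5]
  rfl

end Surface

/-! ### The converse -/

theorem diagOperator_apply (a b : ℝ) (v : Plane) : diagOperator a b v = (a * v.1, b * v.2) := by
  simp [diagOperator]

theorem hasEigenvalue_diagOperator (a b : ℝ) :
    Module.End.HasEigenvalue (diagOperator a b : Plane →ₗ[ℝ] Plane) a ∧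
      Module.End.HasEigenvalue (diagOperator a b : Plane →ₗ[ℝ] Plane) b := by
  constructor
  · refine Module.End.hasEigenvalue_of_hasEigenvector (x := ((1, 0) : Plane))
      ⟨Module.End.mem_eigenspace_iff.2 ?_, by simp⟩
    change diagOperator a b (1, 0) = _
    simp [diagOperator_apply]
  · refine Module.End.hasEigenvalue_of_hasEigenvector (x := ((0, 1) : Plane))
      ⟨Module.End.mem_eigenspace_iff.2 ?_, by simp⟩
    change diagOperator a b (0, 1) = _
    simp [diagOperator_apply]

theorem dPrime_of_diagOperator {S : OperatorField} {A B h : Plane → ℝ} {q : Plane}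
    (hS : S q = diagOperator (A q) (B q)) (hAB : A q ≠ B q) :
    dPrime S A B h q = fderiv ℝ h q (1, 0) • ContinuousLinearMap.fst ℝ ℝ ℝ := by
  have h0 := sub_ne_zero.2 hAB
  refine ContinuousLinearMap.ext fun v => ?_
  have h1 : eigenProj S A B q v = v.1 • (1, 0) := by
    rw [eigenProj, hS, smul_apply, sub_apply, diagOperator_apply]
    ext
    · simp
      field_simp
    · simp
  rw [dPrime, ContinuousLinearMap.comp_apply, h1, map_smul]
  simp [mul_comm]

theorem dDoublePrime_of_diagOperator {S : OperatorField} {A B h : Plane → ℝ} {q : Plane}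
    (hS : S q = diagOperator (A q) (B q)) (hAB : A q ≠ B q) :
    dDoublePrime S A B h q = fderiv ℝ h q (0, 1) • ContinuousLinearMap.snd ℝ ℝ ℝ := by
  have h0 := sub_ne_zero.2 hAB.symm
  refine ContinuousLinearMap.ext fun v => ?_
  have h1 : eigenProj S B A q v = v.2 • (0, 1) := by
    rw [eigenProj, hS, smul_apply, sub_apply, diagOperator_apply]
    ext
    · simp
    · simp
      field_simp
  rw [dDoublePrime, ContinuousLinearMap.comp_apply, h1, map_smul]
  simp [mul_comm]

theorem dForm_smul_const {k : Plane → ℝ} {q : Plane} (hk : DifferentiableAt ℝ k q)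
    (σ : Plane →L[ℝ] ℝ) (v w : Plane) :
    dForm (fun q => k q • σ) q v w = fderiv ℝ k q v * σ w - fderiv ℝ k q w * σ v := by
  rw [dForm_smul hk (differentiableAt_const σ)]
  simp [dForm]

/-- The function `φ₁ - y φ₀`. -/
def linearPencil (φ₀ φ₁ : ℝ → ℝ) (q : Plane) : ℝ := φ₁ q.1 - q.2 * φ₀ q.1

/-- The coefficient `μ` of the equation `φ'' + μ φ = 0` with the solutions `φ₀`, `φ₁`. -/
noncomputable def potential (φ₀ φ₁ : ℝ → ℝ) (x : ℝ) : ℝ :=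
  deriv φ₀ x * deriv (deriv φ₁) x - deriv φ₁ x * deriv (deriv φ₀) x

theorem hasFDerivAt_linearPencil {φ₀ φ₁ : ℝ → ℝ} {a b : ℝ} {q : Plane}
    (h₀ : HasDerivAt φ₀ a q.1) (h₁ : HasDerivAt φ₁ b q.1) :
    HasFDerivAt (linearPencil φ₀ φ₁) ((b - q.2 * a) • ContinuousLinearMap.fst ℝ ℝ ℝ -
      φ₀ q.1 • ContinuousLinearMap.snd ℝ ℝ ℝ) q := by
  have h1 : HasFDerivAt (fun q : Plane => q.1) (ContinuousLinearMap.fst ℝ ℝ ℝ) q := hasFDerivAt_fst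
  have h2 : HasFDerivAt (fun q : Plane => q.2) (ContinuousLinearMap.snd ℝ ℝ ℝ) q := hasFDerivAt_snd
  refine ((h₁.comp_hasFDerivAt q h1).fun_sub
    (h2.fun_mul (h₀.comp_hasFDerivAt q h1))).congr_fderiv ?_
  refine ContinuousLinearMap.ext fun v => ?_
  simp
  ring

theorem explicitU_eq (f φ₀ φ₁ g : ℝ → ℝ) : explicitU f φ₀ φ₁ g = fun q => f q.1 -
    g q.2 * (linearPencil (deriv φ₀) (deriv φ₁) q)⁻¹ -
    linearPencil φ₀ φ₁ q * (linearPencil (deriv φ₀) (deriv φ₁) q)⁻¹ * deriv f q.1 := by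
  funext q
  simp only [explicitU, linearPencil, div_eq_mul_inv]

theorem explicitV_eq (f φ₀ φ₁ g : ℝ → ℝ) : explicitV f φ₀ φ₁ g = fun q => f q.1 -
    φ₀ q.1 * g q.2 - linearPencil φ₀ φ₁ q * deriv g q.2 := rfl

/-! ### Derivatives of the explicit normal form -/

namespace IsNormalFormData

variable {I J : Set ℝ} {f φ₀ φ₁ g : ℝ → ℝ} {q : Plane}

theorem hasDerivAt_of_contDiffOn {k : ℝ → ℝ} {I : Set ℝ} (hI : IsOpen I) (hk : ContDiffOn ℝ ∞ k I)
    {x : ℝ} (hx : x ∈ I) : HasDerivAt k (deriv k x) x :=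
  ((hk.contDiffAt (hI.mem_nhds hx)).differentiableAt (by simp)).hasDerivAt

/-- Differentiating the Wronskian gives φ₀φ₁'' = φ₁φ₀''; with the Wronskian equal to 1, this
exhibits both second derivatives as the same multiple of the solutions. -/
theorem deriv_deriv (h : IsNormalFormData I J f φ₀ φ₁ g) (hI : IsOpen I) {x : ℝ} (hx : x ∈ I) :
    deriv (deriv φ₀) x = -(potential φ₀ φ₁ x * φ₀ x) ∧
      deriv (deriv φ₁) x = -(potential φ₀ φ₁ x * φ₁ x) := by
  have h0 := hasDerivAt_of_contDiffOn hI h.smooth_φ₀ hx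
  have h1 := hasDerivAt_of_contDiffOn hI h.smooth_φ₁ hx
  have h0' := hasDerivAt_of_contDiffOn hI (h.smooth_φ₀.deriv_of_isOpen hI (by simp)) hx
  have h1' := hasDerivAt_of_contDiffOn hI (h.smooth_φ₁.deriv_of_isOpen hI (by simp)) hx
  have hw := h.wronskian x hx
  have hd := (h0.fun_mul h1').fun_sub (h1.fun_mul h0')
  have hc : HasDerivAt (fun x => φ₀ x * deriv φ₁ x - φ₁ x * deriv φ₀ x) 0 x :=
    (hasDerivAt_const x (1 : ℝ)).congr_of_eventuallyEq
      (by filter_upwards [hI.mem_nhds hx] with y hy using h.wronskian y hy)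
  have hz := hd.unique hc
  simp only [potential]
  constructor
  · linear_combination (-deriv (deriv φ₀) x) * hw + (deriv φ₀ x) * hz
  · linear_combination (-deriv (deriv φ₁) x) * hw + (deriv φ₁ x) * hz

theorem hasFDerivAt_numerator (h : IsNormalFormData I J f φ₀ φ₁ g) (hI : IsOpen I)
    (hq : q ∈ I ×ˢ J) : HasFDerivAt (linearPencil φ₀ φ₁)
    (linearPencil (deriv φ₀) (deriv φ₁) q • ContinuousLinearMap.fst ℝ ℝ ℝ -
      φ₀ q.1 • ContinuousLinearMap.snd ℝ ℝ ℝ) q :=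
  hasFDerivAt_linearPencil (hasDerivAt_of_contDiffOn hI h.smooth_φ₀ hq.1)
    (hasDerivAt_of_contDiffOn hI h.smooth_φ₁ hq.1)

theorem hasFDerivAt_denominator (h : IsNormalFormData I J f φ₀ φ₁ g) (hI : IsOpen I)
    (hq : q ∈ I ×ˢ J) : HasFDerivAt (linearPencil (deriv φ₀) (deriv φ₁))
    ((-(potential φ₀ φ₁ q.1 * linearPencil φ₀ φ₁ q)) • ContinuousLinearMap.fst ℝ ℝ ℝ -
      deriv φ₀ q.1 • ContinuousLinearMap.snd ℝ ℝ ℝ) q := by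
  refine (hasFDerivAt_linearPencil
    (hasDerivAt_of_contDiffOn hI (h.smooth_φ₀.deriv_of_isOpen hI (by simp)) hq.1)
    (hasDerivAt_of_contDiffOn hI (h.smooth_φ₁.deriv_of_isOpen hI (by simp)) hq.1)).congr_fderiv ?_
  obtain ⟨h0, h1⟩ := h.deriv_deriv hI hq.1
  rw [h0, h1]
  congr 2
  simp only [linearPencil]
  ring

theorem denominator_ne_zero (h : IsNormalFormData I J f φ₀ φ₁ g) (hq : q ∈ I ×ˢ J) :
    linearPencil (deriv φ₀) (deriv φ₁) q ≠ 0 := h.denom_ne_zero _ hq.1 _ hq.2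

theorem pencil_wronskian (h : IsNormalFormData I J f φ₀ φ₁ g) (hq : q ∈ I ×ˢ J) :
    φ₀ q.1 * linearPencil (deriv φ₀) (deriv φ₁) q - linearPencil φ₀ φ₁ q * deriv φ₀ q.1 = 1 := by
  rw [← h.wronskian _ hq.1]
  simp only [linearPencil]
  ring

/-- The bracket is the common factor R, which reappears in ∂V/∂x and in V - U. It cancels from θ₁
and θ₂, so the coframing depends on φ₀, φ₁ alone. -/
theorem fderiv_explicitU (h : IsNormalFormData I J f φ₀ φ₁ g) (hI : IsOpen I) (hJ : IsOpen J)
    (hq : q ∈ I ×ˢ J) : fderiv ℝ (explicitU f φ₀ φ₁ g) q (0, 1) =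
      (deriv f q.1 - deriv φ₀ q.1 * g q.2 -
        linearPencil (deriv φ₀) (deriv φ₁) q * deriv g q.2) *
        (linearPencil (deriv φ₀) (deriv φ₁) q ^ 2)⁻¹ := by
  have hD := h.hasFDerivAt_denominator hI hq
  have hN := h.hasFDerivAt_numerator hI hq
  have hD0 := h.denominator_ne_zero hq
  have hw := h.pencil_wronskian hq
  have h1 : HasFDerivAt (fun q : Plane => q.1) (ContinuousLinearMap.fst ℝ ℝ ℝ) q := hasFDerivAt_fst
  have h2 : HasFDerivAt (fun q : Plane => q.2) (ContinuousLinearMap.snd ℝ ℝ ℝ) q := hasFDerivAt_snd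
  have hf := (hasDerivAt_of_contDiffOn hI h.smooth_f hq.1).comp_hasFDerivAt q h1
  have hf' := (hasDerivAt_of_contDiffOn hI
    (h.smooth_f.deriv_of_isOpen hI (by simp)) hq.1).comp_hasFDerivAt q h1
  have hg := (hasDerivAt_of_contDiffOn hJ h.smooth_g hq.2).comp_hasFDerivAt q h2
  have hDi := (hasDerivAt_inv hD0).comp_hasFDerivAt q hD
  have hU := (hf.fun_sub (hg.fun_mul hDi)).fun_sub ((hN.fun_mul hDi).fun_mul hf')
  rw [show fderiv ℝ (explicitU f φ₀ φ₁ g) q = _ from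
    (congrArg (fderiv ℝ · q) (explicitU_eq f φ₀ φ₁ g)).trans hU.fderiv]
  simp
  field_simp
  linear_combination (deriv f q.1) * hw

theorem fderiv_explicitV (h : IsNormalFormData I J f φ₀ φ₁ g) (hI : IsOpen I) (hJ : IsOpen J)
    (hq : q ∈ I ×ˢ J) : fderiv ℝ (explicitV f φ₀ φ₁ g) q (1, 0) =
      deriv f q.1 - deriv φ₀ q.1 * g q.2 -
        linearPencil (deriv φ₀) (deriv φ₁) q * deriv g q.2 := by
  have hN := h.hasFDerivAt_numerator hI hq
  have h1 : HasFDerivAt (fun q : Plane => q.1) (ContinuousLinearMap.fst ℝ ℝ ℝ) q := hasFDerivAt_fst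
  have h2 : HasFDerivAt (fun q : Plane => q.2) (ContinuousLinearMap.snd ℝ ℝ ℝ) q := hasFDerivAt_snd
  have hf := (hasDerivAt_of_contDiffOn hI h.smooth_f hq.1).comp_hasFDerivAt q h1
  have hφ₀ := (hasDerivAt_of_contDiffOn hI h.smooth_φ₀ hq.1).comp_hasFDerivAt q h1
  have hg := (hasDerivAt_of_contDiffOn hJ h.smooth_g hq.2).comp_hasFDerivAt q h2
  have hg' := (hasDerivAt_of_contDiffOn hJ
    (h.smooth_g.deriv_of_isOpen hJ (by simp)) hq.2).comp_hasFDerivAt q h2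
  have hV := (hf.fun_sub (hφ₀.fun_mul hg)).fun_sub (hN.fun_mul hg')
  rw [show fderiv ℝ (explicitV f φ₀ φ₁ g) q = _ from hV.fderiv]
  simp
  ring

theorem explicitV_sub_explicitU (h : IsNormalFormData I J f φ₀ φ₁ g) (hq : q ∈ I ×ˢ J) :
    explicitV f φ₀ φ₁ g q - explicitU f φ₀ φ₁ g q =
      linearPencil φ₀ φ₁ q * (linearPencil (deriv φ₀) (deriv φ₁) q)⁻¹ *
        (deriv f q.1 - deriv φ₀ q.1 * g q.2 -
          linearPencil (deriv φ₀) (deriv φ₁) q * deriv g q.2) := by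
  have hD0 := h.denominator_ne_zero hq
  have hw := h.pencil_wronskian hq
  rw [explicitU_eq, explicitV_eq]
  field_simp
  linear_combination (-g q.2) * hw

theorem smooth_coordinates (h : IsNormalFormData I J f φ₀ φ₁ g) (hI : IsOpen I) (hJ : IsOpen J) :
    ContDiffOn ℝ ∞ (linearPencil φ₀ φ₁) (I ×ˢ J) ∧
    ContDiffOn ℝ ∞ (linearPencil (deriv φ₀) (deriv φ₁)) (I ×ˢ J) ∧
    ContDiffOn ℝ ∞ (fun q : Plane => potential φ₀ φ₁ q.1) (I ×ˢ J) ∧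
    ContDiffOn ℝ ∞ (explicitU f φ₀ φ₁ g) (I ×ˢ J) ∧
    ContDiffOn ℝ ∞ (explicitV f φ₀ φ₁ g) (I ×ˢ J) := by
  have hx : ∀ {k : ℝ → ℝ}, ContDiffOn ℝ ∞ k I →
      ContDiffOn ℝ ∞ (fun q : Plane => k q.1) (I ×ˢ J) :=
    fun hk => hk.comp contDiffOn_fst fun q hq => hq.1
  have hy : ∀ {k : ℝ → ℝ}, ContDiffOn ℝ ∞ k J →
      ContDiffOn ℝ ∞ (fun q : Plane => k q.2) (I ×ˢ J) :=
    fun hk => hk.comp contDiffOn_snd fun q hq => hq.2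
  have hd : ∀ {k : ℝ → ℝ} {I : Set ℝ}, IsOpen I → ContDiffOn ℝ ∞ k I →
      ContDiffOn ℝ ∞ (deriv k) I := fun hI hk => hk.deriv_of_isOpen hI (by simp)
  have h0 := h.smooth_φ₀
  have h1 := h.smooth_φ₁
  have hN : ContDiffOn ℝ ∞ (linearPencil φ₀ φ₁) (I ×ˢ J) :=
    (hx h1).sub (contDiffOn_snd.mul (hx h0))
  have hD : ContDiffOn ℝ ∞ (linearPencil (deriv φ₀) (deriv φ₁)) (I ×ˢ J) :=
    (hx (hd hI h1)).sub (contDiffOn_snd.mul (hx (hd hI h0)))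
  have hDi := hD.inv fun q hq => h.denominator_ne_zero hq
  refine ⟨hN, hD, ((hx (hd hI h0)).mul (hx (hd hI (hd hI h1)))).sub
    ((hx (hd hI h1)).mul (hx (hd hI (hd hI h0)))), ?_, ?_⟩
  · rw [explicitU_eq]
    exact ((hx h.smooth_f).sub ((hy h.smooth_g).mul hDi)).sub
      ((hN.mul hDi).mul (hx (hd hI h.smooth_f)))
  · rw [explicitV_eq]
    exact ((hx h.smooth_f).sub ((hx h0).mul (hy h.smooth_g))).sub (hN.mul (hy (hd hJ h.smooth_g)))

/-- Admissible data give an operator of Type I, with principal coordinates. -/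
theorem isTypeIOn_explicitS (h : IsNormalFormData I J f φ₀ φ₁ g) (hI : IsOpen I) (hJ : IsOpen J)
    (hUV : ∀ q ∈ I ×ˢ J, explicitU f φ₀ φ₁ g q ≠ 0 ∧ explicitV f φ₀ φ₁ g q ≠ 0 ∧
      explicitU f φ₀ φ₁ g q ≠ explicitV f φ₀ φ₁ g q) :
    IsTypeIOn (I ×ˢ J) (explicitS f φ₀ φ₁ g) (explicitA f φ₀ φ₁ g) (explicitB f φ₀ φ₁ g) ∧
      ∃ s t : Plane → ℝ, ∀ q ∈ I ×ˢ J, s q ≠ 0 ∧ t q ≠ 0 ∧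
        theta1 (explicitS f φ₀ φ₁ g) (explicitA f φ₀ φ₁ g) (explicitB f φ₀ φ₁ g) q =
          s q • ContinuousLinearMap.fst ℝ ℝ ℝ ∧
        theta2 (explicitS f φ₀ φ₁ g) (explicitA f φ₀ φ₁ g) (explicitB f φ₀ φ₁ g) q =
          t q • ContinuousLinearMap.snd ℝ ℝ ℝ := by
  set U := explicitU f φ₀ φ₁ g with hU
  set V := explicitV f φ₀ φ₁ g with hV
  set S := explicitS f φ₀ φ₁ g with hS
  set A := explicitA f φ₀ φ₁ g with hA
  set B := explicitB f φ₀ φ₁ g with hB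
  set N := linearPencil φ₀ φ₁ with hNdef
  set D := linearPencil (deriv φ₀) (deriv φ₁) with hDdef
  obtain ⟨hNs, hDs, hμs, hUs, hVs⟩ := h.smooth_coordinates hI hJ
  have hWo : IsOpen (I ×ˢ J) := hI.prod hJ
  have hAe : A = fun q => (U q)⁻¹ := by funext q; simp [hA, explicitA, hU]
  have hBe : B = fun q => (V q)⁻¹ := by funext q; simp [hB, explicitB, hV]
  have hAs : ContDiffOn ℝ ∞ A (I ×ˢ J) := by rw [hAe]; exact hUs.inv fun q hq => (hUV q hq).1
  have hBs : ContDiffOn ℝ ∞ B (I ×ˢ J) := by rw [hBe]; exact hVs.inv fun q hq => (hUV q hq).2.1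
  have hSd : ∀ q, S q = diagOperator (A q) (B q) := fun _ => rfl
  have hD0 : ∀ q ∈ I ×ˢ J, D q ≠ 0 := fun q hq => h.denominator_ne_zero hq
  have hprod : ∀ q ∈ I ×ˢ J, V q - U q = N q * (D q)⁻¹ * fderiv ℝ V q (1, 0) := fun q hq => by
    rw [hV, h.fderiv_explicitV hI hJ hq]; exact h.explicitV_sub_explicitU hq
  -- V - U is the product of N/D and ∂V/∂x, so U ≠ V alone forces both N and ∂V/∂x to be nonzero,
  -- and with them nondegeneracy.
  have hne : ∀ q ∈ I ×ˢ J, N q ≠ 0 ∧ fderiv ℝ V q (1, 0) ≠ 0 := fun q hq => by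
    have h1 := sub_ne_zero.2 (hUV q hq).2.2.symm
    rw [hprod q hq] at h1
    exact ⟨left_ne_zero_of_mul (left_ne_zero_of_mul h1), right_ne_zero_of_mul h1⟩
  have hUy : ∀ q ∈ I ×ˢ J, fderiv ℝ U q (0, 1) = fderiv ℝ V q (1, 0) * (D q ^ 2)⁻¹ :=
    fun q hq => by rw [hU, hV, h.fderiv_explicitU hI hJ hq, h.fderiv_explicitV hI hJ hq]
  have hUd : ∀ q ∈ I ×ˢ J, HasFDerivAt U (fderiv ℝ U q) q := fun q hq =>
    ((hUs.contDiffAt (hWo.mem_nhds hq)).differentiableAt (by simp)).hasFDerivAt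
  have hVd : ∀ q ∈ I ×ˢ J, HasFDerivAt V (fderiv ℝ V q) q := fun q hq =>
    ((hVs.contDiffAt (hWo.mem_nhds hq)).differentiableAt (by simp)).hasFDerivAt
  have hAy : ∀ q ∈ I ×ˢ J,
      fderiv ℝ A q (0, 1) = -(fderiv ℝ V q (1, 0) * (D q ^ 2)⁻¹ * (U q ^ 2)⁻¹) := fun q hq => by
    have hd := (hasDerivAt_inv (hUV q hq).1).comp_hasFDerivAt q (hUd q hq)
    rw [show fderiv ℝ A q = _ from (congrArg (fderiv ℝ · q) hAe).trans hd.fderiv,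
      _root_.smul_apply, hUy q hq, smul_eq_mul]
    ring
  have hBx : ∀ q ∈ I ×ˢ J, fderiv ℝ B q (1, 0) = -(fderiv ℝ V q (1, 0) * (V q ^ 2)⁻¹) :=
    fun q hq => by
      have hd := (hasDerivAt_inv (hUV q hq).2.1).comp_hasFDerivAt q (hVd q hq)
      rw [show fderiv ℝ B q = _ from (congrArg (fderiv ℝ · q) hBe).trans hd.fderiv,
        _root_.smul_apply, smul_eq_mul]
      ring
  have hAB : ∀ q ∈ I ×ˢ J, A q ≠ B q := fun q hq => by
    rw [hAe, hBe]; exact fun h => (hUV q hq).2.2 (inv_injective h)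
  have hdB : ∀ q ∈ I ×ˢ J, dPrime S A B B q =
      (-(fderiv ℝ V q (1, 0) * (V q ^ 2)⁻¹)) • ContinuousLinearMap.fst ℝ ℝ ℝ := fun q hq => by
    rw [dPrime_of_diagOperator (hSd q) (hAB q hq), hBx q hq]
  have hdA : ∀ q ∈ I ×ˢ J, dDoublePrime S A B A q =
      (-(fderiv ℝ V q (1, 0) * (D q ^ 2)⁻¹ * (U q ^ 2)⁻¹)) • ContinuousLinearMap.snd ℝ ℝ ℝ :=
    fun q hq => by rw [dDoublePrime_of_diagOperator (hSd q) (hAB q hq), hAy q hq]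
  have hθ₁ : ∀ q ∈ I ×ˢ J, theta1 S A B q = (D q * (N q)⁻¹) • ContinuousLinearMap.fst ℝ ℝ ℝ := by
    intro q hq
    rw [theta1, hdB q hq, smul_smul]
    congr 1
    obtain ⟨hN0, hR0⟩ := hne q hq
    obtain ⟨hU0, hV0, hUV0⟩ := hUV q hq
    have hDq := hD0 q hq
    have hp := hprod q hq
    have hm : U q - V q ≠ 0 := sub_ne_zero.2 hUV0
    rw [hAe, hBe]
    have e1 : (V q)⁻¹ - (U q)⁻¹ = (U q - V q) * ((U q)⁻¹ * (V q)⁻¹) := by field_simp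
    have e2 : U q - V q = -(N q * (D q)⁻¹ * fderiv ℝ V q (1, 0)) := by linear_combination -hp
    simp only [e1, e2]
    field_simp
  have hθ₂ : ∀ q ∈ I ×ˢ J,
      theta2 S A B q = (-((D q)⁻¹ * (N q)⁻¹)) • ContinuousLinearMap.snd ℝ ℝ ℝ := by
    intro q hq
    rw [theta2, hdA q hq, smul_smul]
    congr 1
    obtain ⟨hN0, hR0⟩ := hne q hq
    obtain ⟨hU0, hV0, hUV0⟩ := hUV q hq
    have hDq := hD0 q hq
    have hp := hprod q hq
    rw [hAe, hBe]
    have e1 : (U q)⁻¹ - (V q)⁻¹ = (V q - U q) * ((U q)⁻¹ * (V q)⁻¹) := by field_simp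
    simp only [e1, hp]
    field_simp
  have hstr : ∀ q ∈ I ×ˢ J, D q * (N q)⁻¹ ≠ 0 ∧ -((D q)⁻¹ * (N q)⁻¹) ≠ 0 := fun q hq =>
    ⟨mul_ne_zero (hD0 q hq) (inv_ne_zero (hne q hq).1),
      neg_ne_zero.2 (mul_ne_zero (inv_ne_zero (hD0 q hq)) (inv_ne_zero (hne q hq).1))⟩
  refine ⟨⟨⟨?_, hAs, hBs, fun q _ => (hasEigenvalue_diagOperator _ _).1,
    fun q _ => (hasEigenvalue_diagOperator _ _).2, hAB, fun q hq => ?_, fun q hq => ?_,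
    fun q hq => ?_, fun q hq => ?_⟩, ?_⟩, _, _, fun q hq =>
    ⟨(hstr q hq).1, (hstr q hq).2, hθ₁ q hq, hθ₂ q hq⟩⟩
  · have hSe : S = fun q => A q • (ContinuousLinearMap.fst ℝ ℝ ℝ).prod 0 +
        B q • (0 : Plane →L[ℝ] ℝ).prod (ContinuousLinearMap.snd ℝ ℝ ℝ) := by
      funext q
      refine ContinuousLinearMap.ext fun v => ?_
      rw [hSd, diagOperator_apply]
      simp
    rw [hSe]
    exact (hAs.smul contDiffOn_const).add (hBs.smul contDiffOn_const)
  · rw [hAe]; exact inv_ne_zero (hUV q hq).1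
  · rw [hBe]; exact inv_ne_zero (hUV q hq).2.1
  · rw [hdA q hq]
    refine smul_ne_zero (neg_ne_zero.2 (mul_ne_zero (mul_ne_zero (hne q hq).2
      (inv_ne_zero (pow_ne_zero 2 (hD0 q hq)))) (inv_ne_zero (pow_ne_zero 2 (hUV q hq).1)))) ?_
    exact fun h0 => by simpa using DFunLike.congr_fun h0 (0, 1)
  · rw [hdB q hq]
    refine smul_ne_zero (neg_ne_zero.2 (mul_ne_zero (hne q hq).2
      (inv_ne_zero (pow_ne_zero 2 (hUV q hq).2.1)))) ?_
    exact fun h0 => by simpa using DFunLike.congr_fun h0 (1, 0)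
  -- This inverts μ = (1 - K)e^(-2L) of the direct part, where e^L = N/D.
  · set K : Plane → ℝ := fun q => 1 - potential φ₀ φ₁ q.1 * (N q * (D q)⁻¹) ^ 2 with hK
    have hKs : ContDiffOn ℝ ∞ K (I ×ˢ J) :=
      contDiffOn_const.sub (hμs.mul ((hNs.mul (hDs.inv hD0)).pow 2))
    refine ⟨K, fun q => fderiv ℝ K q (1, 0) / (D q * (N q)⁻¹), hKs, fun q hq => ?_⟩
    have hnear : ∀ᶠ q in 𝓝 q, q ∈ I ×ˢ J := hWo.mem_nhds hq
    have hDd := h.hasFDerivAt_denominator hI hq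
    have hNd := h.hasFDerivAt_numerator hI hq
    have hw := h.pencil_wronskian hq
    rw [← hDdef, ← hNdef] at hDd hNd hw
    have hDq := hD0 q hq
    have hNq := (hne q hq).1
    have hDi := (hasDerivAt_inv hDq).comp_hasFDerivAt q hDd
    have hNi := (hasDerivAt_inv hNq).comp_hasFDerivAt q hNd
    have hs : HasFDerivAt (fun q => D q * (N q)⁻¹) _ q := hDd.fun_mul hNi
    have ht : HasFDerivAt (fun q => -((D q)⁻¹ * (N q)⁻¹)) _ q := (hDi.fun_mul hNi).fun_neg
    have e1 : theta1 S A B =ᶠ[𝓝 q] fun q => (D q * (N q)⁻¹) • ContinuousLinearMap.fst ℝ ℝ ℝ :=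
      hnear.mono hθ₁
    have e2 : theta2 S A B =ᶠ[𝓝 q] fun q => (-((D q)⁻¹ * (N q)⁻¹)) • ContinuousLinearMap.snd ℝ ℝ ℝ :=
      hnear.mono hθ₂
    refine ⟨fun v w => ?_, fun v w => ?_, ?_⟩
    · rw [dForm_congr e1, dForm_smul_const hs.differentiableAt, hs.fderiv, wedge, hθ₁ q hq,
        hθ₂ q hq]
      simp
      field_simp
      linear_combination (v.2 * w.1 - v.1 * w.2) * hw
    · rw [dForm_congr e2, dForm_smul_const ht.differentiableAt, ht.fderiv, wedge, hθ₁ q hq,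
        hθ₂ q hq]
      simp [hK]
      field_simp
      ring
    · have hμd : HasFDerivAt (fun q : Plane => potential φ₀ φ₁ q.1)
          (deriv (potential φ₀ φ₁) q.1 • ContinuousLinearMap.fst ℝ ℝ ℝ) q := by
        have hμI : ContDiffOn ℝ ∞ (potential φ₀ φ₁) I := by
          have hd : ∀ {k : ℝ → ℝ}, ContDiffOn ℝ ∞ k I → ContDiffOn ℝ ∞ (deriv k) I :=
            fun hk => hk.deriv_of_isOpen hI (by simp)
          exact ((hd h.smooth_φ₀).mul (hd (hd h.smooth_φ₁))).sub
            ((hd h.smooth_φ₁).mul (hd (hd h.smooth_φ₀)))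
        exact (hasDerivAt_of_contDiffOn hI hμI hq.1).comp_hasFDerivAt q hasFDerivAt_fst
      have hKd : HasFDerivAt K _ q := (hμd.fun_mul ((hNd.fun_mul hDi).pow 2)).const_sub 1
      -- Only the dy-component of dK carries a condition; the coefficient of θ₁ is free and was
      -- defined as the dx-component divided by D/N.
      have hKy : fderiv ℝ K q (0, 1) = (2 * (K q - 1)) * -((D q)⁻¹ * (N q)⁻¹) := by
        rw [hKd.fderiv]
        simp [hK]
        field_simp
        linear_combination (potential φ₀ φ₁ q.1) * hw
      refine ContinuousLinearMap.ext fun v => ?_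
      rw [clm_apply_plane, hKy, hθ₁ q hq, hθ₂ q hq]
      simp
      field_simp

end IsNormalFormData

/-- Local normal form for operators of Type I, its computability, and the converse. -/
theorem theorem3 :
    -- every operator of Type I has the explicit normal form near each point of the surface,
    -- and the normal form is computable in any given coordinates `e₀`
    (∀ (M : Type*) [TopologicalSpace M] [ChartedSpace Plane M] [IsManifold 𝓘(ℝ, Plane) ∞ M]
      (S : ∀ p : M, TangentSpace 𝓘(ℝ, Plane) p →L[ℝ] TangentSpace 𝓘(ℝ, Plane) p)
      (A B : M → ℝ), IsTypeI S A B →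
      ∀ e₀ ∈ IsManifold.maximalAtlas 𝓘(ℝ, Plane) ∞ M, ∀ p ∈ e₀.source,
        ∃ e ∈ IsManifold.maximalAtlas 𝓘(ℝ, Plane) ∞ M,
        ∃ (x₁ x₂ y₁ y₂ : ℝ) (f φ₀ φ₁ g : ℝ → ℝ),
          p ∈ e.source ∧ e.source ⊆ e₀.source ∧
          e.target = Ioo x₁ x₂ ×ˢ Ioo y₁ y₂ ∧
          IsThetaRectangular (e₀ '' e.source)
            (theta1 (localRep S e₀) (A ∘ e₀.symm) (B ∘ e₀.symm))
            (theta2 (localRep S e₀) (A ∘ e₀.symm) (B ∘ e₀.symm)) ∧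
          IsNormalFormData (Ioo x₁ x₂) (Ioo y₁ y₂) f φ₀ φ₁ g ∧
          (∀ q ∈ e.target,
            A (e.symm q) = explicitA f φ₀ φ₁ g q ∧ B (e.symm q) = explicitB f φ₀ φ₁ g q ∧
            localRep S e q = explicitS f φ₀ φ₁ g q) ∧
          IsComputableFrom (e₀ '' e.source) (localRep S e₀) (A ∘ e₀.symm) (B ∘ e₀.symm)
            (Ioo x₁ x₂) (fun q => (e (e₀.symm q)).1) (fun q => (e (e₀.symm q)).2)
            f φ₀ φ₁ g) ∧
    -- conversely, admissible data give an operator of Type I with principal coordinates `(x, y)`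
    (∀ (I J : Set ℝ) (f φ₀ φ₁ g : ℝ → ℝ),
      IsOpen I → I.OrdConnected → IsOpen J → J.OrdConnected →
      IsNormalFormData I J f φ₀ φ₁ g →
      (∀ q ∈ I ×ˢ J, explicitU f φ₀ φ₁ g q ≠ 0 ∧ explicitV f φ₀ φ₁ g q ≠ 0 ∧
        explicitU f φ₀ φ₁ g q ≠ explicitV f φ₀ φ₁ g q) →
      IsTypeIOn (I ×ˢ J) (explicitS f φ₀ φ₁ g) (explicitA f φ₀ φ₁ g) (explicitB f φ₀ φ₁ g) ∧
        ∃ s t : Plane → ℝ, ∀ q ∈ I ×ˢ J, s q ≠ 0 ∧ t q ≠ 0 ∧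
          theta1 (explicitS f φ₀ φ₁ g) (explicitA f φ₀ φ₁ g) (explicitB f φ₀ φ₁ g) q =
            s q • ContinuousLinearMap.fst ℝ ℝ ℝ ∧
          theta2 (explicitS f φ₀ φ₁ g) (explicitA f φ₀ φ₁ g) (explicitB f φ₀ φ₁ g) q =
            t q • ContinuousLinearMap.snd ℝ ℝ ℝ) := by
  refine ⟨fun M _ _ _ S A B h e₀ he₀ p hp => ?_,
    fun I J f φ₀ φ₁ g hI _ hJ _ hN hUV => hN.isTypeIOn_explicitS hI hJ hUV⟩
  obtain ⟨Φ, x₁, x₂, y₁, y₂, f, φ₀, φ₁, g, hpΦ, hsub, hΦ, hΦ', htgt, hrect, hdata, heig, hcomp⟩ :=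
    (h e₀ he₀).exists_normalForm e₀.open_target (e₀.map_source hp)
  -- The new chart is `e₀` followed by the planar normal form coordinates `Φ`; its domain, seen
  -- through `e₀`, is the planar rectangle neighbourhood.
  have himage : e₀ '' (e₀.trans Φ).source = Φ.source := by
    rw [OpenPartialHomeomorph.trans_source, e₀.image_source_inter_eq']
    ext q
    refine ⟨fun hq => ?_, fun hq => ⟨hsub hq, ?_⟩⟩
    · simpa [e₀.right_inv hq.1] using hq.2
    · simpa [e₀.right_inv (hsub hq)] using hq
  have htarget : (e₀.trans Φ).target = Φ.target := by
    rw [OpenPartialHomeomorph.trans_target]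
    exact inter_eq_left.2 fun q hq => hsub (Φ.map_target hq)
  refine ⟨e₀.trans Φ, trans_mem_maximalAtlas he₀ hΦ hΦ', x₁, x₂, y₁, y₂, f, φ₀, φ₁, g, ?_, ?_,
    htarget.trans htgt, by rwa [himage], hdata, fun q hq => ?_, ?_⟩
  · rw [OpenPartialHomeomorph.trans_source]
    exact ⟨hp, hpΦ⟩
  · rw [OpenPartialHomeomorph.trans_source]
    exact inter_subset_left
  · rw [htarget] at hq
    obtain ⟨hA, hB, hS⟩ := heig _ (Φ.map_target hq)
    rw [Φ.right_inv hq] at hA hB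
    refine ⟨hA, hB, ContinuousLinearMap.ext fun v => ?_⟩
    rw [localRep_trans S he₀ hΦ hΦ' hsub hq, hS, fderiv_apply_fderiv_symm hΦ hΦ' hq, hA, hB]
    rfl
  · rw [himage]
    have hright : ∀ q ∈ Φ.source, (e₀.trans Φ) (e₀.symm q) = Φ q := fun q hq =>
      congrArg Φ (e₀.right_inv (hsub hq))
    exact hcomp.congr (fun q hq => congrArg Prod.fst (hright q hq))
      fun q hq => congrArg Prod.snd (hright q hq)
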